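/- Let $d\ge 1$, let $\mathbb T^d$ be the $d$-torus with angles $\boldsymbol\theta$ and normalized Lebesgue measure $\mu$, and let $\Lambda\subset\mathbb Z^d$ be finite with $\mathbf 0\in\Lambda$ and $-\Lambda=\Lambda$; put $\Lambda_0=\Lambda\setminus\{\mathbf 0\}$. All families of coefficients are real and symmetric ($x_{-\mathbf k}=x_{\mathbf k}$). For $\mathbf p=(p_{\mathbf k})_{\mathbf k\in\Lambda_0}$ and $\mathbf q=(q_{\mathbf k})_{\mathbf k\in\Lambda}$ let $$P=1+\sum_{\mathbf k\in\Lambda_0}p_{\mathbf k}e^{-i\langle\mathbf k,\boldsymbol\theta\rangle},\qquad Q=\sum_{\mathbf k\in\Lambda}q_{\mathbf k}e^{-i\langle\mathbf k,\boldsymbol\theta\rangle},$$ and let $\mathfrak P_{+,o}$ (resp. $\mathfrak P_+$) be the set of $\mathbf p$ (resp. $\mathbf q$) with $P>0$ (resp. $Q>0$) everywhere on $\mathbb T^d$. Let $\Gamma(\Phi)=\big(\int e^{i\langle\mathbf k,\boldsymbol\theta\rangle}\Phi\,d\mu\big)_{\mathbf k\in\Lambda}$ and let $\Gamma_0$ be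 the same with $\Lambda_0$ in place of $\Lambda$. Let $\mathscr C_+$ be the set of all $\mathbf c=\Gamma(\Phi_0)$, where $\Phi_0\ge 0$ is integrable, even in $\boldsymbol\theta$, and strictly positive on some nonempty open ball, and let $\mathscr M$ be the space of all real symmetric families $\mathbf m=(m_{\mathbf k})_{\mathbf k\in\Lambda_0}$. Fix an integer $\nu\ge\frac d2+1$. For $(\mathbf p,\mathbf q)\in\mathfrak P_{+,o}\times\mathfrak P_+$ and $\lambda>0$ put $$\mathbf f(\mathbf p,\mathbf q,\lambda)=\Big(-\Gamma\big((P/Q)^\nu\big),\ \Gamma_0\big(\tfrac{\nu}{\nu-1}(P/Q)^{\nu-1}-\lambda P^{-\nu}\big)\Big).$$ Then: 1. For each fixed $\lambda>0$, the map $\omega(\mathbf p,\mathbf q)=\mathbf f(\mathbf p,\mathbf q,\lambda)$ is a $C^\infty$ diffeomorphism of the open set $\mathfrak P_{+,o}\times\mathfrak P_+$ onto the open set $-\mathscr C_+\times\mathscr M$. 2. For each fixed $(\mathbf c,\mathbf m)\in\mathscr C_+\times\mathscr M$ and every $\lambda>0$, the equation $\mathbf f(\mathbf p,\mathbf q,\lambda)=(-\mathbf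 c,\mathbf m)$ has a unique solution $(\mathbf p_\lambda,\mathbf q_\lambda)\in\mathfrak P_{+,o}\times\mathfrak P_+$, and it is a $C^\infty$ function of $\lambda\in(0,\infty)$. 3. The regularized dual problem of minimizing $$J_{\nu,\lambda}(\mathbf p,\mathbf q)=\frac1{\nu-1}\int\frac{P^\nu}{Q^{\nu-1}}\,d\mu+\sum_{\mathbf k\in\Lambda}q_{\mathbf k}c_{\mathbf k}-\sum_{\mathbf k\in\Lambda_0}p_{\mathbf k}m_{\mathbf k}+\frac{\lambda}{\nu-1}\int\frac1{P^{\nu-1}}\,d\mu\in(-\infty,\infty]$$ over $\overline{\mathfrak P}_{+,o}\times\overline{\mathfrak P}_+$ (with $a/0=\infty$ for $a>0$ in the integrands) is well-posed in the sense of Hadamard: for all $(\mathbf c,\mathbf m)\in\mathscr C_+\times\mathscr M$ and $\lambda>0$ it has a unique solution; a point solves it if and only if it lies in $\mathfrak P_{+,o}\times\mathfrak P_+$ and satisfies $\mathbf f(\mathbf p,\mathbf q,\lambda)=(-\mathbf c,\mathbf m)$; and the solution depends continuously on $(\mathbf c,\mathbf m,\lambda)\in\mathscr C_+\times\mathscr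 M\times(0,\infty)$. -/

import Mathlib

open MeasureTheory Set
open scoped ContDiff ENNReal ComplexConjugate

namespace CepstralMoment

noncomputable section

/-- Normalized Lebesgue (Haar) measure on the `d`-torus. The torus is parametrized by `t = θ / 2π`
in `(ℝ/ℤ)^d`, so that `UnitAddTorus.mFourier k t = exp (i ⟨k, θ⟩)`. -/
def torusMeasure (d : ℕ) : Measure (UnitAddTorus (Fin d)) :=
  Measure.pi fun _ => (AddCircle.haarAddCircle : Measure UnitAddCircle)

/-- Real families `x = (x_k)_{k ∈ I}` such that `x_{-k} = x_k`. -/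
def symSeq {d : ℕ} (I : Finset (Fin d → ℤ)) : Submodule ℝ (I → ℝ) where
  carrier := {x | ∀ j k : I, (j : Fin d → ℤ) = -(k : Fin d → ℤ) → x j = x k}
  add_mem' := fun hx hy j k h => by simp [hx j k h, hy j k h]
  zero_mem' := fun _ _ _ => rfl
  smul_mem' := fun a x hx j k h => by simp [hx j k h]

/-- The trigonometric polynomial `∑_{k ∈ I} q_k exp (-i ⟨k, θ⟩)`, as a complex number. -/
def trigSum {d : ℕ} {I : Finset (Fin d → ℤ)} (q : symSeq I) (t : UnitAddTorus (Fin d)) : ℂ :=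
  ∑ k : I, ((q : I → ℝ) k : ℂ) * UnitAddTorus.mFourier (-(k : Fin d → ℤ)) t

/-- The real value of the trigonometric polynomial with symmetric coefficients `q`; for an index
set which is symmetric about the origin, see `trigSum_eq`. -/
def trigPoly {d : ℕ} {I : Finset (Fin d → ℤ)} (q : symSeq I) (t : UnitAddTorus (Fin d)) : ℝ :=
  (trigSum q t).re

theorem trigSum_eq {d : ℕ} {I : Finset (Fin d → ℤ)} (hI : ∀ k ∈ I, -k ∈ I) (q : symSeq I)
    (t : UnitAddTorus (Fin d)) : trigSum q t = (trigPoly q t : ℂ) := by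
  refine (Complex.conj_eq_iff_re.1 ?_).symm
  unfold trigSum
  rw [map_sum]
  let e : I ≃ I :=
    { toFun := fun k => ⟨-k, hI k k.2⟩
      invFun := fun k => ⟨-k, hI k k.2⟩
      left_inv := fun k => by simp
      right_inv := fun k => by simp }
  refine Fintype.sum_equiv e _ _ fun k => ?_
  rw [map_mul, Complex.conj_ofReal, ← UnitAddTorus.mFourier_neg, q.2 (e k) k rfl]
  rfl

/-- The polynomial `P` with coefficients `p_k`, `k ≠ 0`, and `p_0 = 1`. -/
def polyP {d : ℕ} {Λ : Finset (Fin d → ℤ)} (p : symSeq (Λ.erase 0)) (t : UnitAddTorus (Fin d)) :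
    ℝ :=
  1 + trigPoly p t

/-- The cone `𝔓₊` of positive symmetric trigonometric polynomials, as a set of coefficients. -/
def posPoly {d : ℕ} (Λ : Finset (Fin d → ℤ)) : Set (symSeq Λ) :=
  {q | ∀ t, 0 < trigPoly q t}

/-- The set `𝔓₊,ₒ` of positive symmetric trigonometric polynomials with `p_0 = 1`, as a set of
coefficients `(p_k)`, `k ∈ Λ \ {0}`. -/
def posPolyOne {d : ℕ} (Λ : Finset (Fin d → ℤ)) : Set (symSeq (Λ.erase 0)) :=
  {p | ∀ t, 0 < polyP p t}

/-- The Fourier coefficient `∫ exp (i ⟨k, θ⟩) Φ dμ`. -/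
def fourierMoment {d : ℕ} (Φ : UnitAddTorus (Fin d) → ℝ) (k : Fin d → ℤ) : ℂ :=
  ∫ t, UnitAddTorus.mFourier k t * (Φ t : ℂ) ∂torusMeasure d

theorem fourierMoment_neg {d : ℕ} (Φ : UnitAddTorus (Fin d) → ℝ) (k : Fin d → ℤ) :
    fourierMoment Φ (-k) = conj (fourierMoment Φ k) := by
  unfold fourierMoment
  rw [← integral_conj]
  simp only [map_mul, Complex.conj_ofReal, UnitAddTorus.mFourier_neg]

/-- The operator `Γ` that sends a function to its Fourier coefficients indexed in `I`. It is applied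
to even functions only, for which these coefficients are real: see `fourierMoment_eq`. -/
def Gam {d : ℕ} (I : Finset (Fin d → ℤ)) (Φ : UnitAddTorus (Fin d) → ℝ) : symSeq I :=
  ⟨fun k => (fourierMoment Φ k).re, fun j k h => by
    change (fourierMoment Φ j).re = (fourierMoment Φ k).re
    rw [h, fourierMoment_neg, Complex.conj_re]⟩

theorem fourierMoment_eq {d : ℕ} {I : Finset (Fin d → ℤ)} {Φ : UnitAddTorus (Fin d) → ℝ}
    (hΦ : ∀ t, Φ (-t) = Φ t) (k : I) :
    fourierMoment Φ k = ((Gam I Φ : I → ℝ) k : ℂ) := by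
  refine (Complex.conj_eq_iff_re.1 ?_).symm
  rw [← fourierMoment_neg]
  unfold fourierMoment torusMeasure
  have : (AddCircle.haarAddCircle : Measure UnitAddCircle).IsNegInvariant := inferInstance
  have : (Measure.pi fun _ : Fin d =>
      (AddCircle.haarAddCircle : Measure UnitAddCircle)).IsNegInvariant := inferInstance
  rw [← integral_neg_eq_self]
  refine integral_congr_ae (.of_forall fun t => ?_)
  simp [hΦ, UnitAddTorus.mFourier, fourier_apply]

/-- The set `𝒞₊` of covariances `Γ(Φ₀)` of nonnegative integrable even functions `Φ₀` which are
strictly positive on some open ball. -/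
def covSet {d : ℕ} (Λ : Finset (Fin d → ℤ)) : Set (symSeq Λ) :=
  {c | ∃ Φ₀ : UnitAddTorus (Fin d) → ℝ, Integrable Φ₀ (torusMeasure d) ∧ (∀ t, 0 ≤ Φ₀ t) ∧
    (∃ t₀, ∃ r > 0, ∀ t ∈ Metric.ball t₀ r, 0 < Φ₀ t) ∧ (∀ t, Φ₀ (-t) = Φ₀ t) ∧ c = Gam Λ Φ₀}

/-- The moment map `f(p, q, l) = (-Γ((P/Q)^ν), Γ₀(ν/(ν-1) (P/Q)^(ν-1) - l/P^ν))`. The set `ℳ` of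
cepstral data is the whole space `symSeq (Λ.erase 0)`. -/
def momentMap {d : ℕ} (Λ : Finset (Fin d → ℤ)) (ν : ℕ)
    (x : symSeq (Λ.erase 0) × symSeq Λ) (l : ℝ) : symSeq Λ × symSeq (Λ.erase 0) :=
  (-Gam Λ fun t => (polyP x.1 t / trigPoly x.2 t) ^ ν,
    Gam (Λ.erase 0) fun t =>
      (ν : ℝ) / ((ν : ℝ) - 1) * (polyP x.1 t / trigPoly x.2 t) ^ (ν - 1) - l / polyP x.1 t ^ ν)

/-- `f` restricts to a `C^∞` diffeomorphism of the open set `U` onto the open set `V`. -/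
def IsSmoothDiffeoOn {E F : Type*} [NormedAddCommGroup E] [NormedSpace ℝ E]
    [NormedAddCommGroup F] [NormedSpace ℝ F] (f : E → F) (U : Set E) (V : Set F) : Prop :=
  IsOpen U ∧ IsOpen V ∧ BijOn f U V ∧ ContDiffOn ℝ ∞ f U ∧
    ∃ g : F → E, InvOn g f U V ∧ ContDiffOn ℝ ∞ g V

/-- The regularized dual function
`1/(ν-1) ∫ P^ν/Q^(ν-1) dμ + ⟨q, c⟩ - ⟨p, m⟩ + l/(ν-1) ∫ 1/P^(ν-1) dμ`
with values in `(-∞, ∞]`, for nonnegative `P` and `Q`. In the integrals `a / 0 = ∞` for `a > 0`.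
The inner product `⟨p, m⟩` is taken over `Λ \ {0}`: the term with index `0` is a constant. -/
def regDual {d : ℕ} (Λ : Finset (Fin d → ℤ)) (ν : ℕ) (l : ℝ) (c : symSeq Λ)
    (m : symSeq (Λ.erase 0)) (x : symSeq (Λ.erase 0) × symSeq Λ) : EReal :=
  ((ENNReal.ofReal (1 / ((ν : ℝ) - 1)) *
      ∫⁻ t, ENNReal.ofReal (polyP x.1 t) ^ ν / ENNReal.ofReal (trigPoly x.2 t) ^ (ν - 1)
        ∂torusMeasure d +
    ENNReal.ofReal (l / ((ν : ℝ) - 1)) *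
      ∫⁻ t, 1 / ENNReal.ofReal (polyP x.1 t) ^ (ν - 1) ∂torusMeasure d : ℝ≥0∞) : EReal) +
  ((∑ k : Λ, (x.2 : Λ → ℝ) k * (c : Λ → ℝ) k -
    ∑ k : Λ.erase 0, (x.1 : Λ.erase 0 → ℝ) k * (m : Λ.erase 0 → ℝ) k : ℝ) : EReal)

/-- `x = (p, q)` solves the regularized dual problem: it minimizes the regularized dual function
over the product of the closures of `𝔓₊,ₒ` and `𝔓₊`. -/
def IsDualSolution {d : ℕ} (Λ : Finset (Fin d → ℤ)) (ν : ℕ) (l : ℝ) (c : symSeq Λ)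
    (m : symSeq (Λ.erase 0)) (x : symSeq (Λ.erase 0) × symSeq Λ) : Prop :=
  x ∈ closure (posPolyOne Λ) ×ˢ closure (posPoly Λ) ∧
    IsMinOn (regDual Λ ν l c m) (closure (posPolyOne Λ) ×ˢ closure (posPoly Λ)) x

end

end CepstralMoment

/-!
The moment map is the gradient, up to the duality `pairing`, of the integral of
`P ^ ν / Q ^ (ν - 1) / (ν - 1) + l / P ^ (ν - 1) / (ν - 1)`, whose Hessian form in `(p, q)` is
positive definite for `l > 0`. A map on a convex set with this property is injective, and its
derivative is invertible. By the inverse function theorem, applied with `l` as an additional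
variable, `(p, q, l) ↦ (f(p, q, l), l)` is a diffeomorphism onto its image, and smooth dependence of
the solutions on `(c, m, l)` follows.

The image is found by minimizing the dual function. It is lower semicontinuous by Fatou's lemma and
coercive: `p` ranges over a compact set, since the Fourier coefficients of the density `P ≥ 0` are
at most `1`, and `⟨q, c⟩` is positive on the nonzero `Q ≥ 0`. A minimizer is not on the boundary,
where the function is infinite: a nonnegative trigonometric polynomial vanishes to second order at
its zeros, so that its power `-(ν - 1)` is not integrable when `2 (ν - 1) ≥ d`. An interior
minimizer is a critical point, that is, a solution of the moment equations.
-/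

namespace CepstralMoment

open Filter Topology

noncomputable section

variable {d : ℕ}

section SmoothDiffeo

variable {E F G : Type*} [NormedAddCommGroup E] [NormedSpace ℝ E] [NormedAddCommGroup F]
  [NormedSpace ℝ F] [NormedAddCommGroup G] [NormedSpace ℝ G]

theorem IsSmoothDiffeoOn.contDiffOn_of_comp {f : E → F} {U : Set E} {V : Set F}
    (hf : IsSmoothDiffeoOn f U V) {s : G → E} {A : Set G} (hs : MapsTo s A U)
    (hfs : ContDiffOn ℝ ∞ (fun y => f (s y)) A) : ContDiffOn ℝ ∞ s A := by
  obtain ⟨-, -, hbij, -, g, hg, hg_smooth⟩ := hf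
  exact (hg_smooth.comp hfs fun y hy => hbij.mapsTo (hs hy)).congr fun y hy =>
    (hg.1 (hs hy)).symm

theorem IsSmoothDiffeoOn.slice {f : E × G → F} {U : Set E} {V : Set F} {S : Set G}
    (hf : IsSmoothDiffeoOn (fun z => (f z, z.2)) (U ×ˢ S) (V ×ˢ S)) {s : G} (hs : s ∈ S) :
    IsSmoothDiffeoOn (fun x => f (x, s)) U V := by
  obtain ⟨hU, hV, hbij, hf_smooth, g, hg, hg_smooth⟩ := hf
  have hg_snd : ∀ y ∈ V, (g (y, s)).2 = s := fun y hy =>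
    congrArg Prod.snd (hg.2 (mk_mem_prod hy hs))
  have hg_mk : ∀ y ∈ V, ((g (y, s)).1, s) = g (y, s) := fun y hy =>
    Prod.ext rfl (hg_snd y hy).symm
  have hg_mapsTo : MapsTo g (V ×ˢ S) (U ×ˢ S) := hg.1.mapsTo hbij.surjOn
  have hinv : InvOn (fun y => (g (y, s)).1) (fun x => f (x, s)) U V :=
    ⟨fun x hx => congrArg Prod.fst (hg.1 (mk_mem_prod hx hs)), fun y hy => by
      change f ((g (y, s)).1, s) = y
      rw [hg_mk y hy]
      exact congrArg Prod.fst (hg.2 (mk_mem_prod hy hs))⟩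
  refine ⟨?_, ?_, hinv.bijOn (fun x hx => (hbij.mapsTo (mk_mem_prod hx hs)).1)
    fun y hy => (hg_mapsTo (mk_mem_prod hy hs)).1, ?_, _, hinv, ?_⟩
  · simpa [preimage, hs] using hU.preimage (Continuous.prodMk_left s)
  · simpa [preimage, hs] using hV.preimage (Continuous.prodMk_left s)
  · exact hf_smooth.fst.comp (contDiffOn_id.prodMk contDiffOn_const) fun x hx =>
      mk_mem_prod hx hs
  · exact hg_smooth.fst.comp (contDiffOn_id.prodMk contDiffOn_const) fun y hy =>
      mk_mem_prod hy hs

theorem exists_hasFDerivAt_equiv_of_injective [FiniteDimensional ℝ E] [FiniteDimensional ℝ F]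
    (hEF : Module.finrank ℝ E = Module.finrank ℝ F) {f : E → F} {x : E}
    (hf : DifferentiableAt ℝ f x) (hinj : Function.Injective (fderiv ℝ f x)) :
    ∃ f' : E ≃L[ℝ] F, HasFDerivAt f (f' : E →L[ℝ] F) x := by
  refine ⟨(LinearMap.linearEquivOfInjective (fderiv ℝ f x : E →ₗ[ℝ] F) hinj
    hEF).toContinuousLinearEquiv, ?_⟩
  convert! hf.hasFDerivAt using 1

theorem isSmoothDiffeoOn_image [FiniteDimensional ℝ E] [FiniteDimensional ℝ F]
    (hEF : Module.finrank ℝ E = Module.finrank ℝ F) {f : E → F} {U : Set E} (hU : IsOpen U)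
    (hf : ∀ x ∈ U, ContDiffAt ℝ ∞ f x) (hinj : InjOn f U)
    (hf' : ∀ x ∈ U, Function.Injective (fderiv ℝ f x)) : IsSmoothDiffeoOn f U (f '' U) := by
  have : CompleteSpace E := FiniteDimensional.complete ℝ E
  have hf_equiv : ∀ x ∈ U, ∃ f' : E ≃L[ℝ] F, HasFDerivAt f (f' : E →L[ℝ] F) x := fun x hx =>
    exists_hasFDerivAt_equiv_of_injective hEF ((hf x hx).differentiableAt (by simp)) (hf' x hx)
  have hf_open : IsOpenMap (U.domRestrict f) := by
    refine IsOpenMap.of_nhds_le fun x => ?_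
    obtain ⟨f', hf'⟩ := hf_equiv x x.2
    change 𝓝 (f x) ≤ map (f ∘ Subtype.val) (𝓝 x)
    rw [← Filter.map_map, map_nhds_subtype_coe_eq_nhds x.2 (hU.mem_nhds x.2),
      ((hf x x.2).hasStrictFDerivAt' hf' (by simp)).map_nhds_eq_of_equiv]
  let e : OpenPartialHomeomorph E F := OpenPartialHomeomorph.ofContinuousOpenRestrict
    hinj.toPartialEquiv (fun x hx => (hf x hx).continuousAt.continuousWithinAt) hf_open hU
  refine ⟨hU, e.open_target, hinj.bijOn_image, fun x hx => (hf x hx).contDiffWithinAt, e.symm,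
    e.invOn, fun y hy => ?_⟩
  obtain ⟨f', hf'⟩ := hf_equiv _ (e.map_target hy)
  exact (e.contDiffAt_symm hy hf' (hf _ (e.map_target hy))).contDiffWithinAt

theorem injOn_of_lineDeriv_pos {α : Type*} {f : E → α} {B : E → α → ℝ} {U : Set E}
    (hU : Convex ℝ U)
    (hpos : ∀ x ∈ U, ∀ v ≠ 0, 0 < lineDeriv ℝ (fun y => B v (f y)) x v) : InjOn f U := by
  intro x hx y hy hxy
  by_contra hne
  set v := y - x with hv
  let φ : ℝ → ℝ := fun τ => B v (f (x + τ • v))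
  have hφ_line : ∀ τ, lineDeriv ℝ (fun y => B v (f y)) (x + τ • v) v = deriv φ τ := fun τ => by
    simp only [lineDeriv, add_assoc, ← add_smul]
    exact (deriv_comp_const_add φ τ 0).trans (by rw [add_zero])
  have hφ_deriv : ∀ τ ∈ Icc (0 : ℝ) 1, 0 < deriv φ τ := fun τ hτ =>
    hφ_line τ ▸ hpos _ (hU.add_smul_sub_mem hx hy hτ) v (sub_ne_zero.2 (Ne.symm hne))
  have hφ_mono : StrictMonoOn φ (Icc 0 1) := by
    refine strictMonoOn_of_deriv_pos (convex_Icc 0 1) (fun τ hτ => ?_) fun τ hτ =>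
      hφ_deriv τ (interior_subset hτ)
    exact (differentiableAt_of_deriv_ne_zero
      (hφ_deriv τ hτ).ne').continuousAt.continuousWithinAt
  have hφ_lt := hφ_mono (left_mem_Icc.2 zero_le_one) (right_mem_Icc.2 zero_le_one) one_pos
  simp [φ, hv, hxy] at hφ_lt

theorem isSmoothDiffeoOn_image_prodMk [FiniteDimensional ℝ E] [FiniteDimensional ℝ F]
    [FiniteDimensional ℝ G] (hEF : Module.finrank ℝ E = Module.finrank ℝ F) {f : E × G → F}
    {B : E → F →L[ℝ] ℝ} {U : Set E} {S : Set G} (hU : IsOpen U) (hU_conv : Convex ℝ U)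
    (hS : IsOpen S) (hf : ∀ z ∈ U ×ˢ S, ContDiffAt ℝ ∞ f z)
    (hpos : ∀ x ∈ U, ∀ s ∈ S, ∀ v ≠ 0, 0 < lineDeriv ℝ (fun y => B v (f (y, s))) x v) :
    IsSmoothDiffeoOn (fun z => (f z, z.2)) (U ×ˢ S) ((fun z => (f z, z.2)) '' (U ×ˢ S)) := by
  refine isSmoothDiffeoOn_image (by simp [hEF]) (hU.prod hS)
    (fun z hz => (hf z hz).prodMk contDiffAt_snd) ?_ fun z hz => ?_
  · rintro ⟨x, s⟩ hx ⟨y, s'⟩ hy hxy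
    obtain ⟨hfxy, rfl⟩ : f (x, s) = f (y, s') ∧ s = s' := by simpa using hxy
    exact congrArg (·, s)
      (injOn_of_lineDeriv_pos hU_conv (fun x hx => hpos x hx s hy.2) hx.1 hy.1 hfxy)
  · have hfz : HasFDerivAt f (fderiv ℝ f z) z :=
      ((hf z hz).differentiableAt (by simp)).hasFDerivAt
    rw [(hfz.prodMk hasFDerivAt_snd).fderiv, injective_iff_map_eq_zero]
    rintro ⟨v, w⟩ hvw
    obtain ⟨hv, rfl⟩ : fderiv ℝ f z (v, w) = 0 ∧ w = 0 := by simpa using hvw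
    by_contra hne
    have hline : HasLineDerivAt ℝ (fun y => B v (f (y, z.2))) (B v (fderiv ℝ f z (v, 0))) z.1 v :=
      ((B v).hasFDerivAt.comp z.1 (hfz.comp z.1 (hasFDerivAt_prodMk_left z.1 z.2))).hasLineDerivAt v
    have hvpos := hpos z.1 hz.1 z.2 hz.2 v fun h => hne (by rw [h]; rfl)
    rw [hline.lineDeriv, hv, map_zero] at hvpos
    exact hvpos.false

end SmoothDiffeo

section Semicontinuity

variable {X : Type*} [TopologicalSpace X]

theorem exists_isMinOn_of_subset_isCompact {α : Type*} [LinearOrder α] {f : X → α} {S K : Set X}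
    (hS : IsClosed S) (hK : IsCompact K) (hf : LowerSemicontinuous f) {x₀ : X} (hx₀ : x₀ ∈ S)
    (hsub : ∀ x ∈ S, f x ≤ f x₀ → x ∈ K) : ∃ x ∈ S, IsMinOn f S x := by
  have hne : (S ∩ K).Nonempty := ⟨x₀, hx₀, hsub x₀ hx₀ le_rfl⟩
  obtain ⟨x, hx, hmin⟩ := (hf.lowerSemicontinuousOn (S ∩ K)).exists_isMinOn hne (hK.inter_left hS)
  refine ⟨x, hx.1, fun y hy => ?_⟩
  by_cases hyx₀ : f y ≤ f x₀
  · exact hmin ⟨hy, hsub y hy hyx₀⟩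
  · exact (hmin ⟨hx₀, hsub x₀ hx₀ le_rfl⟩ : f x ≤ f x₀).trans (le_of_not_ge hyx₀)

theorem lowerSemicontinuous_lintegral [FirstCountableTopology X] {T : Type*} [MeasurableSpace T]
    {μ : Measure T} {f : X → T → ℝ≥0∞} (hf_meas : ∀ x, Measurable (f x))
    (hf : ∀ t, LowerSemicontinuous fun x => f x t) :
    LowerSemicontinuous fun x => ∫⁻ t, f x t ∂μ := fun x =>
  lowerSemicontinuousAt_iff_le_liminf.2 <|
    (lintegral_mono fun t => lowerSemicontinuousAt_iff_le_liminf.1 (hf t x)).trans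
      (lintegral_liminf_le hf_meas)

theorem lowerSemicontinuous_ennreal_div {f g : X → ℝ≥0∞} (hf : Continuous f) (hg : Continuous g)
    (hf_top : ∀ x, f x ≠ ⊤) : LowerSemicontinuous fun x => f x / g x := by
  intro x
  by_cases hfx : f x = 0
  · intro y hy
    simp [hfx] at hy
  · have hfg : ContinuousAt (fun x => f x / g x) x :=
      ENNReal.Tendsto.div hf.continuousAt (.inl hfx) hg.continuousAt (.inr (hf_top x))
    exact hfg.lowerSemicontinuousAt

end Semicontinuity

theorem exists_pos_mul_norm_le {E : Type*} [NormedAddCommGroup E] [NormedSpace ℝ E]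
    [ProperSpace E] {S : Set E} (hS : IsClosed S) (hS_smul : ∀ a : ℝ, 0 < a → ∀ x ∈ S, a • x ∈ S)
    {f : E → ℝ} (hf : Continuous f) (hf_smul : ∀ (a : ℝ) (x : E), f (a • x) = a * f x)
    (hpos : ∀ x ∈ S, x ≠ 0 → 0 < f x) : ∃ ε > 0, ∀ x ∈ S, ε * ‖x‖ ≤ f x := by
  obtain ⟨ε, hε, hmin⟩ : ∃ ε > 0, ∀ x ∈ S ∩ Metric.sphere 0 1, ε ≤ f x := by
    rcases (S ∩ Metric.sphere 0 1).eq_empty_or_nonempty with h | h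
    · exact ⟨1, one_pos, by simp [h]⟩
    · obtain ⟨x, hx, hmin⟩ :=
        ((isCompact_sphere 0 1).inter_left hS).exists_isMinOn h hf.continuousOn
      exact ⟨f x, hpos x hx.1 (Metric.ne_of_mem_sphere hx.2 one_ne_zero), fun y hy => hmin hy⟩
  refine ⟨ε, hε, fun x hx => ?_⟩
  rcases eq_or_ne x 0 with rfl | hx0
  · simpa using (hf_smul 0 0).ge
  have hn : 0 < ‖x‖ := norm_pos_iff.2 hx0
  have h := hmin (‖x‖⁻¹ • x) ⟨hS_smul _ (inv_pos.2 hn) x hx, by simp [norm_smul, hn.ne']⟩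
  rwa [hf_smul, inv_mul_eq_div, le_div_iff₀ hn] at h

-- For integrable `ρ`, the mass of `ρ` on small balls around a null point would tend to zero.
theorem lintegral_eq_top_of_le_setLIntegral_closedBall {X : Type*} [MetricSpace X]
    [MeasurableSpace X] [OpensMeasurableSpace X] {μ : Measure X} [IsFiniteMeasure μ]
    {ρ : X → ℝ≥0∞} {x₀ : X} (hx₀ : μ {x₀} = 0) {c : ℝ≥0∞} (hc : c ≠ 0)
    (hρ : ∀ᶠ r in 𝓝[>] (0 : ℝ), c ≤ ∫⁻ x in Metric.closedBall x₀ r, ρ x ∂μ) :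
    ∫⁻ x, ρ x ∂μ = ⊤ := by
  by_contra hfin
  have hball : Tendsto (fun r => μ (Metric.closedBall x₀ r)) (𝓝[>] (0 : ℝ)) (𝓝 0) := by
    have h := (tendsto_measure_cthickening_of_isClosed (μ := μ) (s := {x₀})
      ⟨1, one_pos, measure_ne_top _ _⟩ isClosed_singleton).mono_left
      (nhdsWithin_le_nhds (s := Ioi 0))
    rw [hx₀] at h
    refine h.congr' ?_
    filter_upwards [self_mem_nhdsWithin] with r hr
    rw [Metric.cthickening_singleton _ (le_of_lt hr)]
  exact hc (nonpos_iff_eq_zero.1 (ge_of_tendsto (tendsto_setLIntegral_zero hfin hball) hρ))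

section UniformlySmooth

variable {X : Type*} [TopologicalSpace X] [CompactSpace X]

section Integral

variable [MeasurableSpace X] [OpensMeasurableSpace X]

theorem integrable_of_continuous {μ : Measure X} [IsFiniteMeasure μ] {f : X → ℝ}
    (hf : Continuous f) : Integrable f μ :=
  hf.integrable_of_hasCompactSupport (HasCompactSupport.of_compactSpace f)

variable (μ : Measure X) [IsFiniteMeasure μ]

/-- Integration against a finite measure on a compact space, as a continuous linear form on the
space of continuous functions. -/
def integralCLM : C(X, ℝ) →L[ℝ] ℝ :=
  LinearMap.mkContinuous
    { toFun := fun f => ∫ t, f t ∂μ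
      map_add' := fun f g => integral_add (integrable_of_continuous (map_continuous f))
        (integrable_of_continuous (map_continuous g))
      map_smul' := fun a f => integral_const_mul a _ } (μ.real univ) fun f => by
    rw [mul_comm]
    exact norm_integral_le_of_norm_le_const (.of_forall f.norm_coe_le_norm)

theorem integralCLM_apply (f : C(X, ℝ)) : integralCLM μ f = ∫ t, f t ∂μ := rfl

end Integral

variable {E G : Type*} [NormedAddCommGroup E] [NormedSpace ℝ E] [NormedAddCommGroup G]
  [NormedSpace ℝ G]

/-- The family of functions `φ y` on the compact space `X` depends smoothly on the parameter `y`
near `x`, uniformly on `X`: it is a smooth map into the Banach space `C(X, ℝ)`. This is what allows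
differentiation under the integral sign. -/
def UniformlySmoothAt (φ : E → X → ℝ) (x : E) : Prop :=
  ∃ F : E → C(X, ℝ), ContDiffAt ℝ ∞ F x ∧ ∀ᶠ y in 𝓝 x, ∀ t, F y t = φ y t

namespace UniformlySmoothAt

variable {φ ψ : E → X → ℝ} {x : E}

theorem of_clm (L : E →L[ℝ] C(X, ℝ)) : UniformlySmoothAt (fun y t => L y t) x :=
  ⟨L, L.contDiff.contDiffAt, .of_forall fun _ _ => rfl⟩

theorem of_param {f : E → ℝ} (hf : ContDiffAt ℝ ∞ f x) :
    UniformlySmoothAt (fun y (_ : X) => f y) x :=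
  ⟨fun y => f y • 1, hf.smul contDiffAt_const, .of_forall fun _ _ => by simp⟩

theorem comp {g : G → E} {s : G} (hφ : UniformlySmoothAt φ (g s)) (hg : ContDiffAt ℝ ∞ g s) :
    UniformlySmoothAt (fun y => φ (g y)) s := by
  obtain ⟨F, hF, hFφ⟩ := hφ
  exact ⟨F ∘ g, hF.comp s hg, hg.continuousAt.eventually hFφ⟩

theorem add (hφ : UniformlySmoothAt φ x) (hψ : UniformlySmoothAt ψ x) :
    UniformlySmoothAt (fun y t => φ y t + ψ y t) x := by
  obtain ⟨F, hF, hFφ⟩ := hφ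
  obtain ⟨G, hG, hGψ⟩ := hψ
  exact ⟨_, hF.add hG, by filter_upwards [hFφ, hGψ] with y h h' t using by simp [h, h']⟩

theorem sub (hφ : UniformlySmoothAt φ x) (hψ : UniformlySmoothAt ψ x) :
    UniformlySmoothAt (fun y t => φ y t - ψ y t) x := by
  obtain ⟨F, hF, hFφ⟩ := hφ
  obtain ⟨G, hG, hGψ⟩ := hψ
  exact ⟨_, hF.sub hG, by filter_upwards [hFφ, hGψ] with y h h' t using by simp [h, h']⟩

theorem mul (hφ : UniformlySmoothAt φ x) (hψ : UniformlySmoothAt ψ x) :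
    UniformlySmoothAt (fun y t => φ y t * ψ y t) x := by
  obtain ⟨F, hF, hFφ⟩ := hφ
  obtain ⟨G, hG, hGψ⟩ := hψ
  exact ⟨_, hF.mul hG, by filter_upwards [hFφ, hGψ] with y h h' t using by simp [h, h']⟩

theorem pow (hφ : UniformlySmoothAt φ x) (n : ℕ) : UniformlySmoothAt (fun y t => φ y t ^ n) x := by
  obtain ⟨F, hF, hFφ⟩ := hφ
  exact ⟨_, hF.pow n, by filter_upwards [hFφ] with y h t using by simp [h]⟩

theorem inv (hφ : UniformlySmoothAt φ x) (hφ0 : ∀ t, φ x t ≠ 0) :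
    UniformlySmoothAt (fun y t => (φ y t)⁻¹) x := by
  obtain ⟨F, hF, hFφ⟩ := hφ
  have hFx : IsUnit (F x) := by
    rw [ContinuousMap.isUnit_iff_forall_ne_zero]
    exact fun t => hFφ.self_of_nhds t ▸ hφ0 t
  have hF_unit : ∀ᶠ y in 𝓝 x, IsUnit (F y) :=
    hF.continuousAt.eventually (Units.isOpen.mem_nhds hFx)
  obtain ⟨u, hu⟩ := hFx
  refine ⟨Ring.inverse ∘ F, .comp x (hu ▸ contDiffAt_ringInverse ℝ u) hF, ?_⟩
  filter_upwards [hFφ, hF_unit] with y h hy t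
  have hmul := DFunLike.congr_fun (Ring.mul_inverse_cancel (F y) hy) t
  rw [← h]
  exact eq_inv_of_mul_eq_one_right hmul

theorem div (hφ : UniformlySmoothAt φ x) (hψ : UniformlySmoothAt ψ x) (hψ0 : ∀ t, ψ x t ≠ 0) :
    UniformlySmoothAt (fun y t => φ y t / ψ y t) x := by
  simpa only [div_eq_mul_inv] using hφ.mul (hψ.inv hψ0)

theorem continuous (hφ : UniformlySmoothAt φ x) : Continuous (φ x) := by
  obtain ⟨F, -, hFφ⟩ := hφ
  exact funext hFφ.self_of_nhds ▸ map_continuous (F x)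

theorem exists_hasLineDerivAt (hφ : UniformlySmoothAt φ x) (v : E) {φ' : X → ℝ}
    (hφ' : ∀ t, HasLineDerivAt ℝ (fun y => φ y t) (φ' t) x v) :
    ∃ F : E → C(X, ℝ), ∃ F' : C(X, ℝ), HasLineDerivAt ℝ F F' x v ∧ F' = φ' ∧
      ∀ᶠ y in 𝓝 x, F y = φ y := by
  obtain ⟨F, hF, hFφ⟩ := hφ
  have hF' := (hF.differentiableAt (by simp)).hasFDerivAt
  refine ⟨F, fderiv ℝ F x v, hF'.hasLineDerivAt v, funext fun t => ?_,
    hFφ.mono fun y hy => funext hy⟩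
  have hFt : HasLineDerivAt ℝ (fun y => F y t) (fderiv ℝ F x v t) x v :=
    (ContinuousMap.evalCLM ℝ t : C(X, ℝ) →L[ℝ] ℝ).hasFDerivAt.comp_hasDerivAt 0
      (hF'.hasLineDerivAt v)
  have hFφt : (fun y => φ y t) =ᶠ[𝓝 x] fun y => F y t := hFφ.mono fun y hy => (hy t).symm
  exact hFt.unique (hFφt.symm.hasLineDerivAt_iff.2 (hφ' t))

theorem continuous_of_hasLineDerivAt (hφ : UniformlySmoothAt φ x) {v : E} {φ' : X → ℝ}
    (hφ' : ∀ t, HasLineDerivAt ℝ (fun y => φ y t) (φ' t) x v) : Continuous φ' := by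
  obtain ⟨-, F', -, rfl, -⟩ := hφ.exists_hasLineDerivAt v hφ'
  exact map_continuous F'

theorem hasLineDerivAt_integral [MeasurableSpace X] [OpensMeasurableSpace X] {μ : Measure X}
    [IsFiniteMeasure μ] (hφ : UniformlySmoothAt φ x) {v : E} {φ' : X → ℝ}
    (hφ' : ∀ t, HasLineDerivAt ℝ (fun y => φ y t) (φ' t) x v) :
    HasLineDerivAt ℝ (fun y => ∫ t, φ y t ∂μ) (∫ t, φ' t ∂μ) x v := by
  obtain ⟨F, F', hF, rfl, hFφ⟩ := hφ.exists_hasLineDerivAt v hφ'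
  have hint : HasLineDerivAt ℝ (fun y => integralCLM μ (F y)) (integralCLM μ F') x v :=
    (integralCLM μ).hasFDerivAt.comp_hasDerivAt 0 hF
  refine EventuallyEq.hasLineDerivAt_iff ?_ |>.2 hint
  filter_upwards [hFφ] with y hy
  rw [integralCLM_apply, hy]

end UniformlySmoothAt

end UniformlySmooth

section Density

/-- The integrand of the regularized dual functional where `P` and `Q` take the values `a`
and `b`. -/
def dualDensity (ν : ℕ) (l a b : ℝ) : ℝ :=
  1 / ((ν : ℝ) - 1) * (a ^ ν / b ^ (ν - 1)) + l / ((ν : ℝ) - 1) * (1 / a ^ (ν - 1))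

/-- The function `ν/(ν-1) (P/Q)^(ν-1) - l/P^ν` whose Fourier coefficients are the cepstral component
of the moment map, where `P` and `Q` take the values `a` and `b`. -/
def cepstralDensity (ν : ℕ) (l a b : ℝ) : ℝ :=
  (ν : ℝ) / ((ν : ℝ) - 1) * (a / b) ^ (ν - 1) - l / a ^ ν

/-- The differential of `dualDensity` at `(a, b)` in the direction `(a', b')`. -/
def dualGradient (ν : ℕ) (l a b a' b' : ℝ) : ℝ :=
  a' * cepstralDensity ν l a b - b' * (a / b) ^ ν

/-- The Hessian form of `dualDensity` at `(a, b)`, evaluated on the diagonal at `(a', b')`. -/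
def dualHessian (ν : ℕ) (l a b a' b' : ℝ) : ℝ :=
  ν * (a / b) ^ (ν - 2) / b * (a' - a / b * b') ^ 2 + l * ν / a ^ (ν + 1) * a' ^ 2

variable {ν : ℕ} {l : ℝ} {α β : ℝ → ℝ} {a' b' s : ℝ}

theorem hasDerivAt_dualDensity (hν : 2 ≤ ν) (hα : HasDerivAt α a' s) (hβ : HasDerivAt β b' s)
    (hα0 : α s ≠ 0) (hβ0 : β s ≠ 0) :
    HasDerivAt (fun τ => dualDensity ν l (α τ) (β τ)) (dualGradient ν l (α s) (β s) a' b') s := by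
  obtain ⟨n, rfl⟩ := Nat.exists_eq_add_of_le' hν
  have hα_inv := (hasDerivAt_const s (1 : ℝ)).fun_div (hα.fun_pow (n + 1)) (pow_ne_zero _ hα0)
  have hratio := (hα.fun_pow (n + 2)).fun_div (hβ.fun_pow (n + 1)) (pow_ne_zero _ hβ0)
  have hcast : ((n + 2 : ℕ) : ℝ) - 1 = n + 1 := by push_cast; ring
  refine ((hratio.const_mul (1 / (((n + 2 : ℕ) : ℝ) - 1))).fun_add
    (hα_inv.const_mul (l / (((n + 2 : ℕ) : ℝ) - 1)))).congr_deriv ?_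
  have hn : (n + 1 : ℝ) ≠ 0 := by positivity
  simp only [dualGradient, cepstralDensity, hcast, Nat.add_sub_cancel, div_pow,
    show n + 2 - 1 = n + 1 from rfl]
  push_cast
  field_simp
  ring

theorem hasDerivAt_dualGradient (hν : 2 ≤ ν) (hα : HasDerivAt α a' s) (hβ : HasDerivAt β b' s)
    (hα0 : α s ≠ 0) (hβ0 : β s ≠ 0) :
    HasDerivAt (fun τ => dualGradient ν l (α τ) (β τ) a' b')
      (dualHessian ν l (α s) (β s) a' b') s := by
  obtain ⟨n, rfl⟩ := Nat.exists_eq_add_of_le' hν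
  have hα_inv := (hasDerivAt_const s l).fun_div (hα.fun_pow (n + 2)) (pow_ne_zero _ hα0)
  have hratio := hα.fun_div hβ hβ0
  have hcast : ((n + 2 : ℕ) : ℝ) - 1 = n + 1 := by push_cast; ring
  have hcepstral := ((hratio.fun_pow (n + 1)).const_mul
    (((n + 2 : ℕ) : ℝ) / (((n + 2 : ℕ) : ℝ) - 1))).fun_sub hα_inv
  refine ((hcepstral.const_mul a').fun_sub
    ((hratio.fun_pow (n + 2)).const_mul b')).congr_deriv ?_
  have hn : (n + 1 : ℝ) ≠ 0 := by positivity
  simp only [dualHessian, hcast, Nat.add_sub_cancel, div_pow, show n + 2 - 1 = n + 1 from rfl]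
  push_cast
  field_simp
  ring

theorem dualHessian_nonneg (ν : ℕ) (hl : 0 ≤ l) {a b : ℝ} (ha : 0 ≤ a) (hb : 0 ≤ b) (a' b' : ℝ) :
    0 ≤ dualHessian ν l a b a' b' := by
  unfold dualHessian
  positivity

theorem dualHessian_eq_zero_iff (hν : ν ≠ 0) (hl : 0 < l) {a b : ℝ} (ha : 0 < a) (hb : 0 < b) :
    dualHessian ν l a b a' b' = 0 ↔ a' = 0 ∧ b' = 0 := by
  rw [dualHessian, add_eq_zero_iff_of_nonneg (by positivity) (by positivity)]
  constructor
  · rintro ⟨h, h'⟩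
    have ha' : a' = 0 := by simpa [hl.ne', hν, ha.ne'] using h'
    exact ⟨ha', by simpa [ha', hν, ha.ne', hb.ne'] using h⟩
  · rintro ⟨rfl, rfl⟩
    simp

end Density

section Torus

instance : (torusMeasure d).IsAddHaarMeasure := by unfold torusMeasure; infer_instance

instance : IsProbabilityMeasure (torusMeasure d) := by unfold torusMeasure; infer_instance

theorem haarAddCircle_eq_volume :
    (AddCircle.haarAddCircle : Measure UnitAddCircle) = volume := by
  rw [AddCircle.volume_eq_smul_haarAddCircle, ENNReal.ofReal_one, one_smul]

theorem torusMeasure_singleton (hd : 0 < d) (t : UnitAddTorus (Fin d)) :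
    torusMeasure d {t} = 0 := by
  rw [← univ_pi_singleton, torusMeasure, Measure.pi_pi]
  refine Finset.prod_eq_zero (Finset.mem_univ ⟨0, hd⟩) ?_
  rw [haarAddCircle_eq_volume, ← Metric.closedBall_zero, AddCircle.volume_closedBall]
  simp

theorem ofReal_pow_le_torusMeasure_closedBall (t₀ : UnitAddTorus (Fin d)) {r : ℝ} (hr : 0 ≤ r)
    (hr1 : r ≤ 1) : ENNReal.ofReal r ^ d ≤ torusMeasure d (Metric.closedBall t₀ r) := by
  rw [closedBall_pi _ hr, torusMeasure, Measure.pi_pi, ← Fin.prod_const]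
  refine Finset.prod_le_prod' fun i _ => ?_
  rw [haarAddCircle_eq_volume, AddCircle.volume_closedBall]
  exact ENNReal.ofReal_le_ofReal (le_min hr1 (by linarith))

theorem lintegral_inv_pow_eq_top {F : UnitAddTorus (Fin d) → ℝ} {t₀ : UnitAddTorus (Fin d)}
    {C : ℝ} (hF : ∀ t, F t ≤ C * ‖t - t₀‖ ^ 2) (hd : 0 < d) {n : ℕ} (hn : d ≤ 2 * n) :
    ∫⁻ t, (ENNReal.ofReal (F t) ^ n)⁻¹ ∂torusMeasure d = ⊤ := by
  refine lintegral_eq_top_of_le_setLIntegral_closedBall (torusMeasure_singleton hd t₀)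
    (c := (ENNReal.ofReal C ^ n)⁻¹) (by simp) ?_
  filter_upwards [Ioc_mem_nhdsGT one_pos] with r ⟨hr, hr1⟩
  have hr0 : ENNReal.ofReal r ≠ 0 := by simpa using hr
  have hF_ball : ∀ t ∈ Metric.closedBall t₀ r,
      ENNReal.ofReal (F t) ≤ ENNReal.ofReal C * ENNReal.ofReal r ^ 2 := fun t ht => by
    refine (ENNReal.ofReal_le_ofReal (hF t)).trans ?_
    rw [ENNReal.ofReal_mul' (sq_nonneg _), ENNReal.ofReal_pow (norm_nonneg _)]
    gcongr
    exact mem_closedBall_iff_norm.1 ht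
  calc (ENNReal.ofReal C ^ n)⁻¹
      ≤ (ENNReal.ofReal C ^ n)⁻¹ * ((ENNReal.ofReal r ^ (2 * n))⁻¹ * ENNReal.ofReal r ^ d) := by
        refine le_mul_of_one_le_right' ?_
        rw [← ENNReal.div_eq_inv_mul, ENNReal.le_div_iff_mul_le (by simp [hr0]) (by simp), one_mul]
        exact pow_le_pow_right_of_le_one' (ENNReal.ofReal_le_one.2 hr1) hn
    _ = ((ENNReal.ofReal C * ENNReal.ofReal r ^ 2) ^ n)⁻¹ * ENNReal.ofReal r ^ d := by
        rw [mul_pow, ← pow_mul, ENNReal.mul_inv (by simp) (by simp), mul_assoc]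
    _ ≤ ((ENNReal.ofReal C * ENNReal.ofReal r ^ 2) ^ n)⁻¹ *
          torusMeasure d (Metric.closedBall t₀ r) := by
        gcongr
        exact ofReal_pow_le_torusMeasure_closedBall t₀ hr.le hr1
    _ = ∫⁻ _ in Metric.closedBall t₀ r, ((ENNReal.ofReal C * ENNReal.ofReal r ^ 2) ^ n)⁻¹
          ∂torusMeasure d := (setLIntegral_const _ _).symm
    _ ≤ ∫⁻ t in Metric.closedBall t₀ r, (ENNReal.ofReal (F t) ^ n)⁻¹ ∂torusMeasure d :=
        setLIntegral_mono' measurableSet_closedBall fun t ht => by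
          gcongr
          exact hF_ball t ht

/-- The covering map `ℝ^d → (ℝ/ℤ)^d`. -/
def toTorus (x : Fin d → ℝ) : UnitAddTorus (Fin d) := fun i => (x i : UnitAddCircle)

theorem continuous_toTorus : Continuous (toTorus (d := d)) := continuous_pi fun i =>
  (AddCircle.continuous_mk' 1).comp (continuous_apply i)

theorem exists_toTorus_eq (t : UnitAddTorus (Fin d)) :
    ∃ x : Fin d → ℝ, toTorus x = t ∧ ∀ i, |x i| = ‖t i‖ := by
  have hlift : ∀ u : UnitAddCircle, ∃ y : ℝ, (y : UnitAddCircle) = u ∧ |y| = ‖u‖ := fun u => by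
    obtain ⟨y, rfl⟩ := QuotientAddGroup.mk_surjective u
    refine ⟨y - round y, ?_, UnitAddCircle.norm_eq.symm⟩
    rw [AddCircle.coe_sub, sub_eq_self, AddCircle.coe_eq_zero_iff]
    exact ⟨round y, by simp⟩
  choose x hx hnorm using fun i => hlift (t i)
  exact ⟨x, funext hx, hnorm⟩

theorem toTorus_surjective : Function.Surjective (toTorus (d := d)) := fun t =>
  (exists_toTorus_eq t).imp fun _ h => h.1

/-- The function `cos ⟨k, θ⟩` on the torus. -/
def cosChar (k : Fin d → ℤ) : C(UnitAddTorus (Fin d), ℝ) where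
  toFun t := (UnitAddTorus.mFourier k t).re
  continuous_toFun := by fun_prop

theorem cosChar_toTorus (k : Fin d → ℤ) (x : Fin d → ℝ) :
    cosChar k (toTorus x) = Real.cos (2 * Real.pi * ∑ i, k i * x i) := by
  have hexp : UnitAddTorus.mFourier k (toTorus x) =
      Complex.exp ((2 * Real.pi * ∑ i, k i * x i : ℝ) * Complex.I) := by
    simp only [UnitAddTorus.mFourier, toTorus, ContinuousMap.coe_mk, fourier_coe_apply,
      ← Complex.exp_sum]
    push_cast
    rw [Finset.mul_sum, Finset.sum_mul]
    exact congrArg Complex.exp (Finset.sum_congr rfl fun i _ => by ring)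
  change (UnitAddTorus.mFourier k (toTorus x)).re = _
  rw [hexp, Complex.exp_ofReal_mul_I_re]

theorem cosChar_neg_apply (k : Fin d → ℤ) (t : UnitAddTorus (Fin d)) :
    cosChar k (-t) = cosChar k t := by
  obtain ⟨x, rfl⟩ := toTorus_surjective t
  change cosChar k (toTorus (-x)) = _
  simp [cosChar_toTorus]

theorem cosChar_add_add_cosChar_sub (k : Fin d → ℤ) (s t : UnitAddTorus (Fin d)) :
    cosChar k (s + t) + cosChar k (s - t) = 2 * cosChar k s * cosChar k t := by
  obtain ⟨x, rfl⟩ := toTorus_surjective s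
  obtain ⟨y, rfl⟩ := toTorus_surjective t
  change cosChar k (toTorus (x + y)) + cosChar k (toTorus (x - y)) = _
  simp only [cosChar_toTorus, Pi.add_apply, Pi.sub_apply, mul_add, mul_sub, Finset.sum_add_distrib,
    Finset.sum_sub_distrib, Real.cos_add, Real.cos_sub]
  ring

theorem abs_cosChar_le_one (k : Fin d → ℤ) (t : UnitAddTorus (Fin d)) : |cosChar k t| ≤ 1 := by
  obtain ⟨x, rfl⟩ := toTorus_surjective t
  rw [cosChar_toTorus]
  exact Real.abs_cos_le_one _

theorem exists_one_sub_cosChar_le (k : Fin d → ℤ) :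
    ∃ C, ∀ t : UnitAddTorus (Fin d), 1 - cosChar k t ≤ C * ‖t‖ ^ 2 := by
  refine ⟨(2 * Real.pi) ^ 2 / 2 * (∑ i, |(k i : ℝ)|) ^ 2, fun t => ?_⟩
  obtain ⟨x, rfl, hx⟩ := exists_toTorus_eq t
  have hsum : |∑ i, k i * x i| ≤ (∑ i, |(k i : ℝ)|) * ‖toTorus x‖ := by
    rw [Finset.sum_mul]
    refine (Finset.abs_sum_le_sum_abs _ _).trans (Finset.sum_le_sum fun i _ => ?_)
    rw [abs_mul, hx]
    gcongr
    exact norm_le_pi_norm (toTorus x) i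
  calc 1 - cosChar k (toTorus x) ≤ (2 * Real.pi * ∑ i, k i * x i) ^ 2 / 2 := by
        rw [cosChar_toTorus]
        linarith [Real.one_sub_sq_div_two_le_cos (x := 2 * Real.pi * ∑ i, k i * x i)]
    _ = (2 * Real.pi) ^ 2 / 2 * |∑ i, k i * x i| ^ 2 := by rw [sq_abs]; ring
    _ ≤ (2 * Real.pi) ^ 2 / 2 * ((∑ i, |(k i : ℝ)|) * ‖toTorus x‖) ^ 2 := by gcongr
    _ = _ := by ring

theorem integral_mFourier (k : Fin d → ℤ) :
    ∫ t, UnitAddTorus.mFourier k t ∂torusMeasure d = if k = 0 then 1 else 0 := by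
  split_ifs with h
  · simp [h, UnitAddTorus.mFourier_zero]
  obtain ⟨i, hi⟩ := Function.ne_iff.mp h
  simp only [torusMeasure, UnitAddTorus.mFourier, ContinuousMap.coe_mk]
  rw [integral_fintype_prod_eq_prod fun i (t : UnitAddCircle) => fourier (k i) t]
  exact Finset.prod_eq_zero (Finset.mem_univ i)
    (integral_eq_zero_of_add_right_eq_neg (fourier_add_half_inv_index hi Fact.out))

end Torus

section TrigPoly

variable {I : Finset (Fin d → ℤ)}

theorem trigPoly_eq_sum (q : symSeq I) (t : UnitAddTorus (Fin d)) :
    trigPoly q t = ∑ k : I, (q : I → ℝ) k * cosChar (k : Fin d → ℤ) t := by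
  simp [trigPoly, trigSum, cosChar, UnitAddTorus.mFourier_neg]

/-- The map that sends a family of coefficients to its trigonometric polynomial, as a continuous
linear map into the space of continuous functions. -/
def trigPolyCLM (I : Finset (Fin d → ℤ)) : symSeq I →L[ℝ] C(UnitAddTorus (Fin d), ℝ) :=
  LinearMap.toContinuousLinearMap
    (Fintype.linearCombination ℝ (fun k : I => cosChar (k : Fin d → ℤ)) ∘ₗ (symSeq I).subtype)

theorem trigPolyCLM_apply (q : symSeq I) (t : UnitAddTorus (Fin d)) :
    trigPolyCLM I q t = trigPoly q t := by
  simp [trigPolyCLM, trigPoly_eq_sum, Fintype.linearCombination_apply, ContinuousMap.sum_apply]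

theorem continuous_trigPoly (q : symSeq I) : Continuous (trigPoly q) :=
  (map_continuous (trigPolyCLM I q)).congr (trigPolyCLM_apply q)

theorem trigPoly_neg_apply (q : symSeq I) (t : UnitAddTorus (Fin d)) :
    trigPoly q (-t) = trigPoly q t := by
  simp only [trigPoly_eq_sum, cosChar_neg_apply]

theorem exists_trigPoly_add_trigPoly_sub_le (q : symSeq I) : ∃ C, ∀ s t : UnitAddTorus (Fin d),
    trigPoly q (s + t) + trigPoly q (s - t) - 2 * trigPoly q s ≤ C * ‖t‖ ^ 2 := by
  choose C hC using fun k : I => exists_one_sub_cosChar_le (k : Fin d → ℤ)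
  refine ⟨∑ k : I, |(q : I → ℝ) k| * (2 * C k), fun s t => ?_⟩
  have hterm : ∀ k : I, (q : I → ℝ) k * cosChar (k : Fin d → ℤ) (s + t) +
      (q : I → ℝ) k * cosChar (k : Fin d → ℤ) (s - t) -
        2 * ((q : I → ℝ) k * cosChar (k : Fin d → ℤ) s) ≤
      |(q : I → ℝ) k| * (2 * C k) * ‖t‖ ^ 2 := fun k => by
    have hsum := cosChar_add_add_cosChar_sub (k : Fin d → ℤ) s t
    have hcos := sub_nonneg.2 (le_of_abs_le (abs_cosChar_le_one (k : Fin d → ℤ) t))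
    have hcoeff : -((q : I → ℝ) k * cosChar (k : Fin d → ℤ) s) ≤ |(q : I → ℝ) k| := by
      refine (neg_le_abs _).trans ?_
      rw [abs_mul]
      exact mul_le_of_le_one_right (abs_nonneg _) (abs_cosChar_le_one _ _)
    linear_combination (q : I → ℝ) k * hsum + mul_le_mul_of_nonneg_right hcoeff hcos * 2 +
      mul_le_mul_of_nonneg_left (hC k t) (abs_nonneg ((q : I → ℝ) k)) * 2
  simp only [trigPoly_eq_sum, Finset.mul_sum, Finset.sum_mul]
  rw [← Finset.sum_add_distrib, ← Finset.sum_sub_distrib]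
  exact Finset.sum_le_sum fun k _ => hterm k

-- Reflecting `t` in the zero `t₀` gives another nonnegative value, so the second difference at `t₀`
-- dominates the value at `t`.
theorem exists_add_trigPoly_le_mul_norm_sq (q : symSeq I) {a : ℝ}
    (hnonneg : ∀ t, 0 ≤ a + trigPoly q t) {t₀ : UnitAddTorus (Fin d)}
    (hzero : a + trigPoly q t₀ = 0) : ∃ C, ∀ t, a + trigPoly q t ≤ C * ‖t - t₀‖ ^ 2 := by
  obtain ⟨C, hC⟩ := exists_trigPoly_add_trigPoly_sub_le q
  refine ⟨C, fun t => le_trans ?_ (hC t₀ (t - t₀))⟩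
  rw [add_sub_cancel]
  linarith [hnonneg (t₀ - (t - t₀))]

theorem lintegral_inv_add_trigPoly_pow_eq_top (hd : 0 < d) {n : ℕ} (hn : d ≤ 2 * n)
    {q : symSeq I} {a : ℝ} (hnonneg : ∀ t, 0 ≤ a + trigPoly q t)
    (hzero : ∃ t, a + trigPoly q t ≤ 0) :
    ∫⁻ t, (ENNReal.ofReal (a + trigPoly q t) ^ n)⁻¹ ∂torusMeasure d = ⊤ := by
  obtain ⟨t₀, ht₀⟩ := hzero
  obtain ⟨C, hC⟩ := exists_add_trigPoly_le_mul_norm_sq q hnonneg (ht₀.antisymm (hnonneg t₀))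
  exact lintegral_inv_pow_eq_top hC hd hn

theorem trigPoly_eq_zero_of_isOpen {q : symSeq I} {s : Set (UnitAddTorus (Fin d))}
    (hs : IsOpen s) (hne : s.Nonempty) (hq : ∀ t ∈ s, trigPoly q t = 0)
    (t : UnitAddTorus (Fin d)) : trigPoly q t = 0 := by
  have hana : AnalyticOnNhd ℝ (fun x => trigPoly q (toTorus x)) univ := fun x _ => by
    simp only [trigPoly_eq_sum, cosChar_toTorus]
    refine Finset.analyticAt_fun_sum _ fun k _ => analyticAt_const.mul
      (Real.analyticAt_cos.fun_comp (f := fun x : Fin d → ℝ => _) ?_)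
    refine analyticAt_const.mul (Finset.analyticAt_fun_sum _ fun i _ => analyticAt_const.mul ?_)
    exact (ContinuousLinearMap.proj (R := ℝ) (φ := fun _ : Fin d => ℝ) i).analyticAt x
  obtain ⟨t₁, ht₁⟩ := hne
  obtain ⟨x₁, rfl⟩ := toTorus_surjective t₁
  obtain ⟨x, rfl⟩ := toTorus_surjective t
  refine hana.eqOn_zero_of_preconnected_of_eventuallyEq_zero isPreconnected_univ (mem_univ x₁) ?_
    (mem_univ x)
  filter_upwards [(hs.preimage continuous_toTorus).mem_nhds ht₁] with y hy using hq _ hy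

end TrigPoly

section FourierMoments

variable {I : Finset (Fin d → ℤ)}

theorem fourierMoment_trigPoly (hI : ∀ k ∈ I, -k ∈ I) (q : symSeq I) (j : Fin d → ℤ) :
    fourierMoment (trigPoly q) j = if h : j ∈ I then ((q : I → ℝ) ⟨j, h⟩ : ℂ) else 0 := by
  have hexpand : ∀ t, UnitAddTorus.mFourier j t * (trigPoly q t : ℂ) =
      ∑ k : I, ((q : I → ℝ) k : ℂ) * UnitAddTorus.mFourier (j - (k : Fin d → ℤ)) t := fun t => by
    rw [← trigSum_eq hI, trigSum, Finset.mul_sum]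
    refine Finset.sum_congr rfl fun k _ => ?_
    rw [sub_eq_add_neg, UnitAddTorus.mFourier_add, mul_left_comm]
  have hint : ∀ k : I, Integrable (fun t => ((q : I → ℝ) k : ℂ) *
      UnitAddTorus.mFourier (j - (k : Fin d → ℤ)) t) (torusMeasure d) := fun k =>
    (Continuous.integrable_of_hasCompactSupport (by fun_prop) (.of_compactSpace _))
  simp only [fourierMoment, hexpand]
  rw [integral_finsetSum _ fun k _ => hint k]
  simp only [integral_const_mul, integral_mFourier, sub_eq_zero, mul_ite, mul_one, mul_zero]
  split_ifs with h
  · exact (Finset.sum_congr rfl fun k _ => if_congr (Subtype.ext_iff (a1 := ⟨j, h⟩)).symm rfl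
      rfl).trans (by simp)
  · exact Finset.sum_eq_zero fun k _ => if_neg fun hjk : j = k => h (hjk ▸ k.2)

theorem Gam_trigPoly (hI : ∀ k ∈ I, -k ∈ I) (q : symSeq I) : Gam I (trigPoly q) = q := by
  ext k
  change (fourierMoment (trigPoly q) k).re = _
  simp [fourierMoment_trigPoly hI]

theorem eq_zero_of_trigPoly_eq_zero (hI : ∀ k ∈ I, -k ∈ I) {q : symSeq I}
    (hq : ∀ t, trigPoly q t = 0) : q = 0 := by
  have hzero : trigPoly q = trigPoly (0 : symSeq I) := by
    ext t
    rw [hq, ← trigPolyCLM_apply, map_zero, ContinuousMap.zero_apply]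
  rw [← Gam_trigPoly hI q, hzero, Gam_trigPoly hI]

theorem integrable_cosChar_mul {Φ : UnitAddTorus (Fin d) → ℝ}
    (hΦ : Integrable Φ (torusMeasure d)) (k : Fin d → ℤ) :
    Integrable (fun t => cosChar k t * Φ t) (torusMeasure d) :=
  hΦ.bdd_mul (c := 1) (map_continuous _).aestronglyMeasurable
    (.of_forall fun t => abs_cosChar_le_one k t)

theorem Gam_apply (I : Finset (Fin d → ℤ)) {Φ : UnitAddTorus (Fin d) → ℝ}
    (hΦ : Integrable Φ (torusMeasure d)) (k : I) :
    (Gam I Φ : I → ℝ) k = ∫ t, cosChar k t * Φ t ∂torusMeasure d := by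
  have hint : Integrable (fun t => UnitAddTorus.mFourier (k : Fin d → ℤ) t * (Φ t : ℂ))
      (torusMeasure d) :=
    hΦ.ofReal.bdd_mul (c := 1) (map_continuous _).aestronglyMeasurable
      (.of_forall fun t => (ContinuousMap.norm_coe_le_norm _ t).trans UnitAddTorus.mFourier_norm.le)
  change (fourierMoment Φ k).re = _
  rw [fourierMoment, ← RCLike.re_eq_complex_re, ← integral_re hint]
  simp [cosChar]

theorem dotProduct_Gam (q : symSeq I) {Φ : UnitAddTorus (Fin d) → ℝ}
    (hΦ : Integrable Φ (torusMeasure d)) :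
    (q : I → ℝ) ⬝ᵥ (Gam I Φ : I → ℝ) = ∫ t, trigPoly q t * Φ t ∂torusMeasure d := by
  simp only [dotProduct, trigPoly_eq_sum, Finset.sum_mul, Gam_apply I hΦ, mul_assoc]
  rw [integral_finsetSum _ fun k _ => (integrable_cosChar_mul hΦ _).const_mul _]
  simp only [integral_const_mul]

/-- The operator `Γ` on the space of continuous functions, as a continuous linear map. -/
def GamCLM (I : Finset (Fin d → ℤ)) : C(UnitAddTorus (Fin d), ℝ) →L[ℝ] symSeq I :=
  (ContinuousLinearMap.pi fun k : I => integralCLM (torusMeasure d) ∘L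
    ContinuousLinearMap.mul ℝ C(UnitAddTorus (Fin d), ℝ) (cosChar k)).codRestrict (symSeq I)
    fun Φ => by
      convert (Gam I Φ).2
      ext k
      exact (Gam_apply I (integrable_of_continuous (map_continuous Φ)) k).symm

theorem GamCLM_apply (I : Finset (Fin d → ℤ)) (Φ : C(UnitAddTorus (Fin d), ℝ)) :
    GamCLM I Φ = Gam I Φ := by
  ext k
  exact (Gam_apply I (integrable_of_continuous (map_continuous Φ)) k).symm

end FourierMoments

section PolynomialCones

variable {I Λ : Finset (Fin d → ℤ)}

theorem hasLineDerivAt_trigPoly (q q' : symSeq I) (t : UnitAddTorus (Fin d)) :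
    HasLineDerivAt ℝ (fun y => trigPoly y t) (trigPoly q' t) q q' := by
  have h : HasLineDerivAt ℝ (fun y => trigPolyCLM I y t) (trigPolyCLM I q' t) q q' :=
    ((ContinuousMap.evalCLM ℝ t : C(UnitAddTorus (Fin d), ℝ) →L[ℝ] ℝ) ∘L
      trigPolyCLM I).hasFDerivAt.hasLineDerivAt q'
  simpa only [trigPolyCLM_apply] using h

theorem hasLineDerivAt_polyP (p p' : symSeq (Λ.erase 0)) (t : UnitAddTorus (Fin d)) :
    HasLineDerivAt ℝ (fun y => polyP y t) (trigPoly p' t) p p' :=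
  HasDerivAt.const_add 1 (hasLineDerivAt_trigPoly p p' t)

theorem uniformlySmoothAt_trigPoly (q : symSeq I) : UniformlySmoothAt trigPoly q := by
  simpa only [trigPolyCLM_apply] using UniformlySmoothAt.of_clm (x := q) (trigPolyCLM I)

theorem uniformlySmoothAt_polyP (p : symSeq (Λ.erase 0)) : UniformlySmoothAt polyP p :=
  (UniformlySmoothAt.of_param contDiffAt_const).add (uniformlySmoothAt_trigPoly p)

theorem continuous_trigPoly_left (t : UnitAddTorus (Fin d)) :
    Continuous fun q : symSeq I => trigPoly q t :=
  ((continuous_eval_const t).comp (trigPolyCLM I).continuous).congr fun q =>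
    trigPolyCLM_apply q t

theorem continuous_polyP_left (t : UnitAddTorus (Fin d)) :
    Continuous fun p : symSeq (Λ.erase 0) => polyP p t :=
  continuous_const.add (continuous_trigPoly_left t)

theorem continuous_polyP (p : symSeq (Λ.erase 0)) : Continuous (polyP p) :=
  continuous_const.add (continuous_trigPoly p)

theorem trigPoly_smul (a : ℝ) (q : symSeq I) (t : UnitAddTorus (Fin d)) :
    trigPoly (a • q) t = a * trigPoly q t := by
  simp only [← trigPolyCLM_apply, map_smul, ContinuousMap.smul_apply, smul_eq_mul]

theorem trigPoly_add (q q' : symSeq I) (t : UnitAddTorus (Fin d)) :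
    trigPoly (q + q') t = trigPoly q t + trigPoly q' t := by
  simp only [← trigPolyCLM_apply, map_add, ContinuousMap.add_apply]

theorem isOpen_setOf_forall_pos_trigPoly (a : ℝ) :
    IsOpen {q : symSeq I | ∀ t, 0 < a + trigPoly q t} := by
  have hopen := (ContinuousMap.isOpen_setOfPred_mapsTo (X := UnitAddTorus (Fin d)) isCompact_univ
    (isOpen_Ioi (a := (0 : ℝ)))).preimage
      ((continuous_const (y := ContinuousMap.const _ a)).add (trigPolyCLM I).continuous)
  convert hopen
  simp [MapsTo, trigPolyCLM_apply]

theorem convex_setOf_forall_pos_trigPoly (a : ℝ) :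
    Convex ℝ {q : symSeq I | ∀ t, 0 < a + trigPoly q t} := by
  intro q hq q' hq' α β hα hβ hαβ t
  have h := convex_Ioi (0 : ℝ) (hq t) (hq' t) hα hβ hαβ
  simp only [trigPoly_add, trigPoly_smul]
  simp only [smul_eq_mul, mem_Ioi] at h
  linear_combination h + a * hαβ

theorem posPoly_eq : posPoly Λ = {q | ∀ t, 0 < 0 + trigPoly q t} := by
  simp only [posPoly, zero_add]

theorem isOpen_posPoly : IsOpen (posPoly Λ) :=
  posPoly_eq ▸ isOpen_setOf_forall_pos_trigPoly 0

theorem convex_posPoly : Convex ℝ (posPoly Λ) :=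
  posPoly_eq ▸ convex_setOf_forall_pos_trigPoly 0

theorem isOpen_posPolyOne : IsOpen (posPolyOne Λ) :=
  isOpen_setOf_forall_pos_trigPoly 1

theorem convex_posPolyOne : Convex ℝ (posPolyOne Λ) :=
  convex_setOf_forall_pos_trigPoly 1

theorem trigPoly_nonneg_of_mem_closure {q : symSeq Λ} (hq : q ∈ closure (posPoly Λ))
    (t : UnitAddTorus (Fin d)) : 0 ≤ trigPoly q t :=
  closure_minimal (fun _ hq => (hq t).le) (isClosed_Ici.preimage (continuous_trigPoly_left t)) hq

theorem polyP_nonneg_of_mem_closure {p : symSeq (Λ.erase 0)} (hp : p ∈ closure (posPolyOne Λ))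
    (t : UnitAddTorus (Fin d)) : 0 ≤ polyP p t :=
  closure_minimal (fun _ hp => (hp t).le) (isClosed_Ici.preimage (continuous_polyP_left t)) hp

theorem neg_mem_erase_zero (hsymm : ∀ k ∈ Λ, -k ∈ Λ) : ∀ k ∈ Λ.erase 0, -k ∈ Λ.erase 0 := by
  simpa using fun k hk hkΛ => ⟨hk, hsymm k hkΛ⟩

theorem fourierMoment_polyP (hsymm : ∀ k ∈ Λ, -k ∈ Λ) (p : symSeq (Λ.erase 0))
    (k : Fin d → ℤ) : fourierMoment (polyP p) k =
      if h : k ∈ Λ.erase 0 then ((p : Λ.erase 0 → ℝ) ⟨k, h⟩ : ℂ) else if k = 0 then 1 else 0 := by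
  have hint : Integrable (fun t => UnitAddTorus.mFourier k t * (trigPoly p t : ℂ))
      (torusMeasure d) :=
    Continuous.integrable_of_hasCompactSupport
      ((map_continuous _).mul (Complex.continuous_ofReal.comp (continuous_trigPoly p)))
      (.of_compactSpace _)
  have hadd : fourierMoment (polyP p) k =
      (if k = 0 then 1 else 0) + fourierMoment (trigPoly p) k := by
    simp only [fourierMoment, polyP, Complex.ofReal_add, Complex.ofReal_one, mul_add, mul_one]
    rw [integral_add (Continuous.integrable_of_hasCompactSupport (map_continuous _)
      (.of_compactSpace _)) hint, integral_mFourier]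
  rw [hadd, fourierMoment_trigPoly (neg_mem_erase_zero hsymm)]
  rcases eq_or_ne k 0 with rfl | hk
  · simp
  · simp [hk]

theorem integral_polyP (hsymm : ∀ k ∈ Λ, -k ∈ Λ) (p : symSeq (Λ.erase 0)) :
    ∫ t, polyP p t ∂torusMeasure d = 1 := by
  have h := fourierMoment_polyP hsymm p 0
  simp only [fourierMoment, UnitAddTorus.mFourier_zero, ContinuousMap.one_apply, one_mul,
    Finset.notMem_erase, dite_false, if_true, integral_complex_ofReal] at h
  exact_mod_cast h

theorem abs_coeff_le_one (hsymm : ∀ k ∈ Λ, -k ∈ Λ) {p : symSeq (Λ.erase 0)}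
    (hp : ∀ t, 0 ≤ polyP p t) (k : Λ.erase 0) : |(p : Λ.erase 0 → ℝ) k| ≤ 1 := by
  calc |(p : Λ.erase 0 → ℝ) k| = ‖fourierMoment (polyP p) k‖ := by
        simp [fourierMoment_polyP hsymm p k]
    _ ≤ ∫ t, polyP p t ∂torusMeasure d := by
        refine norm_integral_le_of_norm_le (integrable_of_continuous (continuous_polyP p))
          (.of_forall fun t => ?_)
        rw [norm_mul, Complex.norm_of_nonneg (hp t)]
        exact mul_le_of_le_one_left (hp t)
          ((ContinuousMap.norm_coe_le_norm _ t).trans UnitAddTorus.mFourier_norm.le)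
    _ = 1 := integral_polyP hsymm p

theorem isCompact_closure_posPolyOne (hsymm : ∀ k ∈ Λ, -k ∈ Λ) :
    IsCompact (closure (posPolyOne Λ)) := by
  refine (isCompact_closedBall 0 1).of_isClosed_subset isClosed_closure fun p hp => ?_
  rw [mem_closedBall_zero_iff]
  exact (pi_norm_le_iff_of_nonneg zero_le_one).2
    (abs_coeff_le_one hsymm (polyP_nonneg_of_mem_closure hp))

theorem dotProduct_pos_of_mem_covSet (hsymm : ∀ k ∈ Λ, -k ∈ Λ) {c q : symSeq Λ}
    (hc : c ∈ covSet Λ) (hq : ∀ t, 0 ≤ trigPoly q t) (hq0 : q ≠ 0) :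
    0 < (q : Λ → ℝ) ⬝ᵥ (c : Λ → ℝ) := by
  obtain ⟨Φ, hΦ, hΦ0, ⟨t₀, r, hr, hball⟩, -, rfl⟩ := hc
  have hint : Integrable (fun t => trigPoly q t * Φ t) (torusMeasure d) := by
    obtain ⟨C, hC⟩ := isCompact_univ.exists_bound_of_continuousOn
      (continuous_trigPoly q).continuousOn
    exact hΦ.bdd_mul (c := C) (continuous_trigPoly q).aestronglyMeasurable
      (.of_forall fun t => hC t (mem_univ t))
  have hne : ∃ t ∈ Metric.ball t₀ r, trigPoly q t ≠ 0 := by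
    by_contra! hzero
    exact hq0 (eq_zero_of_trigPoly_eq_zero hsymm (trigPoly_eq_zero_of_isOpen Metric.isOpen_ball
      ⟨t₀, Metric.mem_ball_self hr⟩ hzero))
  rw [dotProduct_Gam q hΦ,
    integral_pos_iff_support_of_nonneg (fun t => mul_nonneg (hq t) (hΦ0 t)) hint]
  have hopen : IsOpen (Metric.ball t₀ r ∩ {t | trigPoly q t ≠ 0}) :=
    Metric.isOpen_ball.inter (isOpen_ne_fun (continuous_trigPoly q) continuous_const)
  refine (hopen.measure_pos (torusMeasure d) hne).trans_le (measure_mono ?_)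
  exact fun t ht => mul_ne_zero ht.2 (hball t ht.1).ne'

theorem exists_pos_mul_norm_le_dotProduct (hsymm : ∀ k ∈ Λ, -k ∈ Λ) {c : symSeq Λ}
    (hc : c ∈ covSet Λ) : ∃ ε > 0, ∀ q : symSeq Λ, (∀ t, 0 ≤ trigPoly q t) →
      ε * ‖q‖ ≤ (q : Λ → ℝ) ⬝ᵥ (c : Λ → ℝ) := by
  refine exists_pos_mul_norm_le (S := {q : symSeq Λ | ∀ t, 0 ≤ trigPoly q t}) ?_ ?_ ?_ ?_ ?_
  · simp only [ofPred_forall]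
    exact isClosed_iInter fun t => isClosed_Ici.preimage (continuous_trigPoly_left t)
  · exact fun a ha q hq t => trigPoly_smul a q t ▸ mul_nonneg ha.le (hq t)
  · exact continuous_subtype_val.dotProduct continuous_const
  · exact fun a q => smul_dotProduct a (q : Λ → ℝ) (c : Λ → ℝ)
  · exact fun q hq hq0 => dotProduct_pos_of_mem_covSet hsymm hc hq hq0

end PolynomialCones

section MomentMap

variable {I Λ : Finset (Fin d → ℤ)} {ν : ℕ} {l : ℝ} {x : symSeq (Λ.erase 0) × symSeq Λ}

/-- The duality `⟨p, w₂⟩ + ⟨q, w₁⟩` between coefficients `(p, q)` and data `w`, under which the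
moment map is the gradient of the integral of `dualDensity`. -/
def pairing (Λ : Finset (Fin d → ℤ)) : symSeq (Λ.erase 0) × symSeq Λ →L[ℝ]
    symSeq Λ × symSeq (Λ.erase 0) →L[ℝ] ℝ :=
  (LinearMap.mk₂ ℝ
    (fun v w => (v.1 : Λ.erase 0 → ℝ) ⬝ᵥ (w.2 : Λ.erase 0 → ℝ) + (v.2 : Λ → ℝ) ⬝ᵥ (w.1 : Λ → ℝ))
    (fun v v' w => by simp [add_dotProduct, add_add_add_comm])
    (fun a v w => by simp [mul_add])
    (fun v w w' => by simp [dotProduct_add, add_add_add_comm])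
    (fun a v w => by simp [mul_add])).toContinuousBilinearMap

theorem pairing_apply (v : symSeq (Λ.erase 0) × symSeq Λ) (w : symSeq Λ × symSeq (Λ.erase 0)) :
    pairing Λ v w =
      (v.1 : Λ.erase 0 → ℝ) ⬝ᵥ (w.2 : Λ.erase 0 → ℝ) + (v.2 : Λ → ℝ) ⬝ᵥ (w.1 : Λ → ℝ) := rfl

theorem eq_zero_of_forall_pairing_eq_zero {w : symSeq Λ × symSeq (Λ.erase 0)}
    (hw : ∀ v, pairing Λ v w = 0) : w = 0 := by
  have hfst : (w.1 : Λ → ℝ) = 0 :=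
    dotProduct_self_eq_zero.1 (by simpa [pairing_apply] using hw (0, w.1))
  have hsnd : (w.2 : Λ.erase 0 → ℝ) = 0 :=
    dotProduct_self_eq_zero.1 (by simpa [pairing_apply] using hw (w.2, 0))
  exact Prod.ext (Subtype.ext hfst) (Subtype.ext hsnd)

theorem isOpen_posPolyOne_prod_posPoly : IsOpen (posPolyOne Λ ×ˢ posPoly Λ) :=
  isOpen_posPolyOne.prod isOpen_posPoly

theorem contDiffAt_Gam {E : Type*} [NormedAddCommGroup E] [NormedSpace ℝ E]
    {φ : E → UnitAddTorus (Fin d) → ℝ} {y : E} (hφ : UniformlySmoothAt φ y) :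
    ContDiffAt ℝ ∞ (fun z => Gam I (φ z)) y := by
  obtain ⟨F, hF, hFφ⟩ := hφ
  refine ((GamCLM I).contDiff.contDiffAt.comp y hF).congr_of_eventuallyEq ?_
  filter_upwards [hFφ] with z hz
  rw [Function.comp_apply, GamCLM_apply, funext hz]

theorem uniformlySmoothAt_polyP_fst : UniformlySmoothAt (fun y t => polyP y.1 t) x :=
  (uniformlySmoothAt_polyP x.1).comp contDiffAt_fst

theorem uniformlySmoothAt_trigPoly_snd : UniformlySmoothAt (fun y t => trigPoly y.2 t) x :=
  (uniformlySmoothAt_trigPoly x.2).comp contDiffAt_snd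

theorem uniformlySmoothAt_ratio_pow (hx : x.2 ∈ posPoly Λ) (n : ℕ) :
    UniformlySmoothAt (fun y t => (polyP y.1 t / trigPoly y.2 t) ^ n) x :=
  (uniformlySmoothAt_polyP_fst.div uniformlySmoothAt_trigPoly_snd fun t => (hx t).ne').pow n

theorem uniformlySmoothAt_cepstralDensity {z : (symSeq (Λ.erase 0) × symSeq Λ) × ℝ}
    (hz : z.1 ∈ posPolyOne Λ ×ˢ posPoly Λ) :
    UniformlySmoothAt (fun y t => cepstralDensity ν y.2 (polyP y.1.1 t) (trigPoly y.1.2 t)) z :=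
  ((UniformlySmoothAt.of_param contDiffAt_const).mul
    ((uniformlySmoothAt_ratio_pow hz.2 (ν - 1)).comp contDiffAt_fst)).sub
  ((UniformlySmoothAt.of_param contDiffAt_snd).div
    ((uniformlySmoothAt_polyP_fst.comp contDiffAt_fst).pow ν) fun t => (pow_pos (hz.1 t) ν).ne')

theorem uniformlySmoothAt_dualDensity (hx : x ∈ posPolyOne Λ ×ˢ posPoly Λ) :
    UniformlySmoothAt (fun y t => dualDensity ν l (polyP y.1 t) (trigPoly y.2 t)) x :=
  ((UniformlySmoothAt.of_param contDiffAt_const).mul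
    ((uniformlySmoothAt_polyP_fst.pow ν).div (uniformlySmoothAt_trigPoly_snd.pow (ν - 1))
      fun t => (pow_pos (hx.2 t) _).ne')).add
  ((UniformlySmoothAt.of_param contDiffAt_const).mul
    ((UniformlySmoothAt.of_param contDiffAt_const).div (uniformlySmoothAt_polyP_fst.pow (ν - 1))
      fun t => (pow_pos (hx.1 t) _).ne'))

theorem uniformlySmoothAt_dualGradient (hx : x ∈ posPolyOne Λ ×ˢ posPoly Λ)
    (v : symSeq (Λ.erase 0) × symSeq Λ) :
    UniformlySmoothAt (fun y t => dualGradient ν l (polyP y.1 t) (trigPoly y.2 t)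
      (trigPoly v.1 t) (trigPoly v.2 t)) x :=
  (((uniformlySmoothAt_trigPoly v.1).comp (g := fun _ => v.1) contDiffAt_const).mul
    ((uniformlySmoothAt_cepstralDensity (z := (x, l)) hx).comp (g := fun y => (y, l))
      (contDiffAt_id.prodMk contDiffAt_const))).sub
  (((uniformlySmoothAt_trigPoly v.2).comp (g := fun _ => v.2) contDiffAt_const).mul
    (uniformlySmoothAt_ratio_pow hx.2 ν))

theorem contDiffAt_momentMap {z : (symSeq (Λ.erase 0) × symSeq Λ) × ℝ}
    (hz : z.1 ∈ posPolyOne Λ ×ˢ posPoly Λ) :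
    ContDiffAt ℝ ∞ (fun y => momentMap Λ ν y.1 y.2) z :=
  (contDiffAt_Gam ((uniformlySmoothAt_ratio_pow hz.2 ν).comp contDiffAt_fst)).neg.prodMk
    (contDiffAt_Gam (uniformlySmoothAt_cepstralDensity hz))

theorem pairing_momentMap (hx : x ∈ posPolyOne Λ ×ˢ posPoly Λ)
    (v : symSeq (Λ.erase 0) × symSeq Λ) :
    pairing Λ v (momentMap Λ ν x l) = ∫ t, dualGradient ν l (polyP x.1 t) (trigPoly x.2 t)
      (trigPoly v.1 t) (trigPoly v.2 t) ∂torusMeasure d := by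
  have hratio : Continuous fun t => (polyP x.1 t / trigPoly x.2 t) ^ ν :=
    (uniformlySmoothAt_ratio_pow hx.2 ν).continuous
  have hcepstral : Continuous fun t => cepstralDensity ν l (polyP x.1 t) (trigPoly x.2 t) :=
    (uniformlySmoothAt_cepstralDensity (z := (x, l)) hx).continuous
  have hfst : (v.1 : Λ.erase 0 → ℝ) ⬝ᵥ ((momentMap Λ ν x l).2 : Λ.erase 0 → ℝ) =
      ∫ t, trigPoly v.1 t * cepstralDensity ν l (polyP x.1 t) (trigPoly x.2 t) ∂torusMeasure d :=
    dotProduct_Gam v.1 (integrable_of_continuous hcepstral)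
  have hsnd : (v.2 : Λ → ℝ) ⬝ᵥ ((momentMap Λ ν x l).1 : Λ → ℝ) =
      -∫ t, trigPoly v.2 t * (polyP x.1 t / trigPoly x.2 t) ^ ν ∂torusMeasure d :=
    (dotProduct_neg _ _).trans
      (congrArg _ (dotProduct_Gam v.2 (integrable_of_continuous hratio)))
  rw [pairing_apply, hfst, hsnd, ← sub_eq_add_neg]
  exact (integral_sub
    (integrable_of_continuous ((continuous_trigPoly v.1).mul hcepstral))
    (integrable_of_continuous ((continuous_trigPoly v.2).mul hratio))).symm

theorem hasLineDerivAt_dualDensity (hν : 2 ≤ ν) (hx : x ∈ posPolyOne Λ ×ˢ posPoly Λ)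
    (v : symSeq (Λ.erase 0) × symSeq Λ) (t : UnitAddTorus (Fin d)) :
    HasLineDerivAt ℝ (fun y => dualDensity ν l (polyP y.1 t) (trigPoly y.2 t))
      (dualGradient ν l (polyP x.1 t) (trigPoly x.2 t) (trigPoly v.1 t) (trigPoly v.2 t)) x v := by
  have h := hasDerivAt_dualDensity (l := l) hν (hasLineDerivAt_polyP x.1 v.1 t)
    (hasLineDerivAt_trigPoly x.2 v.2 t)
  simp only [zero_smul, add_zero] at h
  exact h (hx.1 t).ne' (hx.2 t).ne'

theorem hasLineDerivAt_dualGradient (hν : 2 ≤ ν) (hx : x ∈ posPolyOne Λ ×ˢ posPoly Λ)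
    (v : symSeq (Λ.erase 0) × symSeq Λ) (t : UnitAddTorus (Fin d)) :
    HasLineDerivAt ℝ (fun y => dualGradient ν l (polyP y.1 t) (trigPoly y.2 t)
        (trigPoly v.1 t) (trigPoly v.2 t))
      (dualHessian ν l (polyP x.1 t) (trigPoly x.2 t) (trigPoly v.1 t) (trigPoly v.2 t)) x v := by
  have h := hasDerivAt_dualGradient (l := l) hν (hasLineDerivAt_polyP x.1 v.1 t)
    (hasLineDerivAt_trigPoly x.2 v.2 t)
  simp only [zero_smul, add_zero] at h
  exact h (hx.1 t).ne' (hx.2 t).ne'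

theorem hasLineDerivAt_pairing_momentMap (hν : 2 ≤ ν) (hx : x ∈ posPolyOne Λ ×ˢ posPoly Λ)
    (v : symSeq (Λ.erase 0) × symSeq Λ) :
    HasLineDerivAt ℝ (fun y => pairing Λ v (momentMap Λ ν y l))
      (∫ t, dualHessian ν l (polyP x.1 t) (trigPoly x.2 t) (trigPoly v.1 t) (trigPoly v.2 t)
        ∂torusMeasure d) x v := by
  refine ((uniformlySmoothAt_dualGradient hx v).hasLineDerivAt_integral
    (hasLineDerivAt_dualGradient hν hx v)).congr_of_eventuallyEq ?_
  filter_upwards [isOpen_posPolyOne_prod_posPoly.mem_nhds hx] with y hy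
  exact pairing_momentMap hy v

theorem integral_dualHessian_pos (hsymm : ∀ k ∈ Λ, -k ∈ Λ) (hν : 2 ≤ ν) (hl : 0 < l)
    (hx : x ∈ posPolyOne Λ ×ˢ posPoly Λ) {v : symSeq (Λ.erase 0) × symSeq Λ} (hv : v ≠ 0) :
    0 < ∫ t, dualHessian ν l (polyP x.1 t) (trigPoly x.2 t) (trigPoly v.1 t) (trigPoly v.2 t)
      ∂torusMeasure d := by
  have hcont := (uniformlySmoothAt_dualGradient (l := l) hx v).continuous_of_hasLineDerivAt
    (hasLineDerivAt_dualGradient hν hx v)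
  have hne : ∃ t, dualHessian ν l (polyP x.1 t) (trigPoly x.2 t)
      (trigPoly v.1 t) (trigPoly v.2 t) ≠ 0 := by
    by_contra! hzero
    have hv_zero := fun t =>
      (dualHessian_eq_zero_iff (by lia) hl (hx.1 t) (hx.2 t)).1 (hzero t)
    exact hv (Prod.ext
      (eq_zero_of_trigPoly_eq_zero (neg_mem_erase_zero hsymm) fun t => (hv_zero t).1)
      (eq_zero_of_trigPoly_eq_zero hsymm fun t => (hv_zero t).2))
  obtain ⟨t, ht⟩ := hne
  exact hcont.integral_pos_of_hasCompactSupport_nonneg_nonzero (.of_compactSpace _)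
    (fun t => dualHessian_nonneg ν hl.le (hx.1 t).le (hx.2 t).le _ _) ht

theorem isSmoothDiffeoOn_momentMap_image (hsymm : ∀ k ∈ Λ, -k ∈ Λ) (hν : 2 ≤ ν) :
    IsSmoothDiffeoOn (fun z : (symSeq (Λ.erase 0) × symSeq Λ) × ℝ => (momentMap Λ ν z.1 z.2, z.2))
      ((posPolyOne Λ ×ˢ posPoly Λ) ×ˢ Ioi 0)
      ((fun z : (symSeq (Λ.erase 0) × symSeq Λ) × ℝ => (momentMap Λ ν z.1 z.2, z.2)) ''
        ((posPolyOne Λ ×ˢ posPoly Λ) ×ˢ Ioi 0)) := by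
  refine isSmoothDiffeoOn_image_prodMk (B := fun v => pairing Λ v)
    (LinearEquiv.prodComm ℝ _ _).finrank_eq isOpen_posPolyOne_prod_posPoly
    (convex_posPolyOne.prod convex_posPoly) isOpen_Ioi (fun z hz => contDiffAt_momentMap hz.1)
    fun x hx l hl v hv => ?_
  rw [(hasLineDerivAt_pairing_momentMap hν hx v).lineDeriv]
  exact integral_dualHessian_pos hsymm hν hl hx hv

end MomentMap

theorem lintegral_eq_top_of_const_mul_le {T : Type*} [MeasurableSpace T] {μ : Measure T}
    {f g : T → ℝ≥0∞} {a : ℝ≥0∞} (ha : a ≠ 0) (hf : ∫⁻ t, f t ∂μ = ⊤) (hfg : ∀ t, a * f t ≤ g t) :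
    ∫⁻ t, g t ∂μ = ⊤ := by
  rw [← top_le_iff, ← ENNReal.mul_top ha, ← hf]
  exact (lintegral_const_mul_le a f).trans (lintegral_mono hfg)

section DualProblem

variable {Λ : Finset (Fin d → ℤ)} {ν : ℕ} {l : ℝ} {c : symSeq Λ} {m : symSeq (Λ.erase 0)}
  {x : symSeq (Λ.erase 0) × symSeq Λ}

/-- The extension of `dualDensity` to nonnegative `a` and `b`, with values in `[0, ∞]` and
`a / 0 = ∞` for `a > 0`. -/
def extDualDensity (ν : ℕ) (l a b : ℝ) : ℝ≥0∞ :=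
  ENNReal.ofReal (1 / ((ν : ℝ) - 1)) * (ENNReal.ofReal a ^ ν / ENNReal.ofReal b ^ (ν - 1)) +
    ENNReal.ofReal (l / ((ν : ℝ) - 1)) * (1 / ENNReal.ofReal a ^ (ν - 1))

theorem extDualDensity_eq_ofReal (hν : 2 ≤ ν) (hl : 0 ≤ l) {a b : ℝ} (ha : 0 < a) (hb : 0 < b) :
    extDualDensity ν l a b = ENNReal.ofReal (dualDensity ν l a b) := by
  have hν1 : (0 : ℝ) < ν - 1 := sub_pos.2 (Nat.one_lt_cast.2 hν)
  rw [dualDensity, ENNReal.ofReal_add (by positivity) (by positivity),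
    ENNReal.ofReal_mul (by positivity), ENNReal.ofReal_mul (by positivity),
    ENNReal.ofReal_div_of_pos (pow_pos hb _), ENNReal.ofReal_div_of_pos (pow_pos ha _),
    ENNReal.ofReal_pow ha.le, ENNReal.ofReal_pow ha.le, ENNReal.ofReal_pow hb.le,
    ENNReal.ofReal_one, extDualDensity]

theorem dualDensity_nonneg (hν : 2 ≤ ν) (hl : 0 ≤ l) {a b : ℝ} (ha : 0 ≤ a) (hb : 0 ≤ b) :
    0 ≤ dualDensity ν l a b := by
  have hν1 : (0 : ℝ) < ν - 1 := sub_pos.2 (Nat.one_lt_cast.2 hν)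
  unfold dualDensity
  positivity

theorem regDual_eq_lintegral_sub_pairing (Λ : Finset (Fin d → ℤ)) (ν : ℕ) (l : ℝ) (c : symSeq Λ)
    (m : symSeq (Λ.erase 0)) (x : symSeq (Λ.erase 0) × symSeq Λ) :
    regDual Λ ν l c m x =
      ((∫⁻ t, extDualDensity ν l (polyP x.1 t) (trigPoly x.2 t) ∂torusMeasure d : ℝ≥0∞) : EReal) +
        ((-pairing Λ x (-c, m) : ℝ) : EReal) := by
  have hP := (continuous_polyP x.1).measurable
  have hQ := (continuous_trigPoly x.2).measurable
  have hpair : -pairing Λ x (-c, m) =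
      (x.2 : Λ → ℝ) ⬝ᵥ (c : Λ → ℝ) - (x.1 : Λ.erase 0 → ℝ) ⬝ᵥ (m : Λ.erase 0 → ℝ) := by
    simp only [pairing_apply, Submodule.coe_neg, dotProduct_neg]
    ring
  rw [hpair]
  simp only [extDualDensity]
  rw [lintegral_add_left (by fun_prop), lintegral_const_mul _ (by fun_prop),
    lintegral_const_mul _ (by fun_prop)]
  rfl

theorem regDual_eq_coe (hν : 2 ≤ ν) (hl : 0 ≤ l) (hx : x ∈ posPolyOne Λ ×ˢ posPoly Λ) :
    regDual Λ ν l c m x =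
      ((∫ t, dualDensity ν l (polyP x.1 t) (trigPoly x.2 t) ∂torusMeasure d -
        pairing Λ x (-c, m) : ℝ) : EReal) := by
  have hnonneg : ∀ t, 0 ≤ dualDensity ν l (polyP x.1 t) (trigPoly x.2 t) := fun t =>
    dualDensity_nonneg hν hl (hx.1 t).le (hx.2 t).le
  rw [regDual_eq_lintegral_sub_pairing,
    lintegral_congr fun t => extDualDensity_eq_ofReal hν hl (hx.1 t) (hx.2 t),
    ← ofReal_integral_eq_lintegral_ofReal
      (integrable_of_continuous (uniformlySmoothAt_dualDensity hx).continuous)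
      (.of_forall hnonneg),
    EReal.coe_ennreal_ofReal, max_eq_left (integral_nonneg hnonneg), ← EReal.coe_add,
    sub_eq_add_neg]

theorem lintegral_extDualDensity_eq_top (hd : 0 < d) (hν : 2 ≤ ν) (hνd : d ≤ 2 * (ν - 1))
    (hl : 0 < l) (hx : x ∈ closure (posPolyOne Λ) ×ˢ closure (posPoly Λ))
    (hxU : x ∉ posPolyOne Λ ×ˢ posPoly Λ) :
    ∫⁻ t, extDualDensity ν l (polyP x.1 t) (trigPoly x.2 t) ∂torusMeasure d = ⊤ := by
  have hν1 : (0 : ℝ) < ν - 1 := sub_pos.2 (Nat.one_lt_cast.2 hν)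
  by_cases hp : x.1 ∈ posPolyOne Λ
  · have hq : ∃ t, 0 + trigPoly x.2 t ≤ 0 := by
      simpa [posPoly] using fun h : x.2 ∈ posPoly Λ => hxU ⟨hp, h⟩
    have hdiv := lintegral_inv_add_trigPoly_pow_eq_top hd hνd
      (fun t => (zero_add (trigPoly x.2 t)).symm ▸ trigPoly_nonneg_of_mem_closure hx.2 t) hq
    obtain ⟨t₁, -, ht₁⟩ :=
      isCompact_univ.exists_isMinOn univ_nonempty (continuous_polyP x.1).continuousOn
    have hconst : ENNReal.ofReal (1 / ((ν : ℝ) - 1)) * ENNReal.ofReal (polyP x.1 t₁) ^ ν ≠ 0 :=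
      mul_ne_zero (ENNReal.ofReal_pos.2 (by positivity)).ne'
        (pow_ne_zero _ (ENNReal.ofReal_pos.2 (hp t₁)).ne')
    refine lintegral_eq_top_of_const_mul_le hconst hdiv fun t => le_add_right ?_
    have hmin : polyP x.1 t₁ ≤ polyP x.1 t := ht₁ (mem_univ t)
    rw [mul_assoc, zero_add, ← div_eq_mul_inv]
    gcongr
  · have hp' : ∃ t, 1 + trigPoly x.1 t ≤ 0 := by simpa [posPolyOne, polyP] using hp
    have hdiv := lintegral_inv_add_trigPoly_pow_eq_top hd hνd
      (polyP_nonneg_of_mem_closure hx.1) hp'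
    have hconst : ENNReal.ofReal (l / ((ν : ℝ) - 1)) ≠ 0 :=
      (ENNReal.ofReal_pos.2 (by positivity)).ne'
    refine lintegral_eq_top_of_const_mul_le hconst hdiv fun t => ?_
    rw [← one_div]
    exact le_add_left le_rfl

theorem regDual_eq_top (hd : 0 < d) (hν : 2 ≤ ν) (hνd : d ≤ 2 * (ν - 1)) (hl : 0 < l)
    (hx : x ∈ closure (posPolyOne Λ) ×ˢ closure (posPoly Λ))
    (hxU : x ∉ posPolyOne Λ ×ˢ posPoly Λ) : regDual Λ ν l c m x = ⊤ := by
  rw [regDual_eq_lintegral_sub_pairing, lintegral_extDualDensity_eq_top hd hν hνd hl hx hxU]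
  exact EReal.top_add_coe _

theorem lowerSemicontinuous_extDualDensity {X : Type*} [TopologicalSpace X] (ν : ℕ) (l : ℝ)
    {f g : X → ℝ} (hf : Continuous f) (hg : Continuous g) :
    LowerSemicontinuous fun x => extDualDensity ν l (f x) (g x) := by
  have hpow : ∀ {h : X → ℝ} (n : ℕ), Continuous h → Continuous fun x => ENNReal.ofReal (h x) ^ n :=
    fun n hh => (ENNReal.continuous_pow n).comp (ENNReal.continuous_ofReal.comp hh)
  have hmul : ∀ (a : ℝ) {h : X → ℝ≥0∞}, LowerSemicontinuous h →
      LowerSemicontinuous fun x => ENNReal.ofReal a * h x := fun a h hh =>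
    (ENNReal.continuous_const_mul ENNReal.ofReal_ne_top).comp_lowerSemicontinuous hh
      fun _ _ hab => mul_le_mul_right hab _
  exact (hmul _ (lowerSemicontinuous_ennreal_div (hpow _ hf) (hpow _ hg)
    fun _ => ENNReal.pow_ne_top ENNReal.ofReal_ne_top)).add
    (hmul _ (lowerSemicontinuous_ennreal_div continuous_const (hpow _ hf)
      fun _ => ENNReal.one_ne_top))

theorem lowerSemicontinuous_regDual (ν : ℕ) (l : ℝ) (c : symSeq Λ) (m : symSeq (Λ.erase 0)) :
    LowerSemicontinuous (regDual Λ ν l c m) := by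
  have hlintegral : LowerSemicontinuous fun x : symSeq (Λ.erase 0) × symSeq Λ =>
      ∫⁻ t, extDualDensity ν l (polyP x.1 t) (trigPoly x.2 t) ∂torusMeasure d := by
    refine lowerSemicontinuous_lintegral (fun x => ?_) fun t =>
      lowerSemicontinuous_extDualDensity ν l ((continuous_polyP_left t).comp continuous_fst)
        ((continuous_trigPoly_left t).comp continuous_snd)
    have hP := (continuous_polyP x.1).measurable
    have hQ := (continuous_trigPoly x.2).measurable
    unfold extDualDensity
    fun_prop
  have hcoe := continuous_coe_ennreal_ereal.comp_lowerSemicontinuous hlintegral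
    fun _ _ h => EReal.coe_ennreal_le_coe_ennreal_iff.2 h
  have hpair : Continuous fun x => ((-pairing Λ x (-c, m) : ℝ) : EReal) :=
    continuous_coe_real_ereal.comp (by fun_prop)
  rw [funext (regDual_eq_lintegral_sub_pairing Λ ν l c m)]
  exact hcoe.add' hpair.lowerSemicontinuous fun x =>
    EReal.continuousAt_add (.inr (EReal.coe_ne_bot _)) (.inr (EReal.coe_ne_top _))

theorem posPolyOne_prod_posPoly_nonempty (h0 : (0 : Fin d → ℤ) ∈ Λ) :
    (posPolyOne Λ ×ˢ posPoly Λ).Nonempty := by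
  let q : symSeq Λ := ⟨Pi.single ⟨0, h0⟩ 1, fun j k h => by
    simp [Pi.single_apply, Subtype.ext_iff, h]⟩
  refine ⟨(0, q), fun t => ?_, fun t => ?_⟩
  · simp [polyP, trigPoly_eq_sum]
  · simp [trigPoly_eq_sum, q, Pi.single_apply, cosChar, UnitAddTorus.mFourier]

theorem exists_le_regDual (hsymm : ∀ k ∈ Λ, -k ∈ Λ) (ν : ℕ) (l : ℝ) (hc : c ∈ covSet Λ)
    (m : symSeq (Λ.erase 0)) : ∃ ε > 0, ∃ M : ℝ,
      ∀ x ∈ closure (posPolyOne Λ) ×ˢ closure (posPoly Λ),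
        ((ε * ‖x.2‖ - M : ℝ) : EReal) ≤ regDual Λ ν l c m x := by
  obtain ⟨ε, hε, hcoercive⟩ := exists_pos_mul_norm_le_dotProduct hsymm hc
  refine ⟨ε, hε, ∑ k, |(m : Λ.erase 0 → ℝ) k|, fun x hx => ?_⟩
  have hq := hcoercive x.2 (trigPoly_nonneg_of_mem_closure hx.2)
  have hp : (x.1 : Λ.erase 0 → ℝ) ⬝ᵥ (m : Λ.erase 0 → ℝ) ≤ ∑ k, |(m : Λ.erase 0 → ℝ) k| := by
    refine Finset.sum_le_sum fun k _ => (le_abs_self _).trans ?_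
    rw [abs_mul]
    exact mul_le_of_le_one_left (abs_nonneg _)
      (abs_coeff_le_one hsymm (polyP_nonneg_of_mem_closure hx.1) k)
  exact (EReal.coe_le_coe_iff.2 (sub_le_sub hq hp)).trans
    (le_add_of_nonneg_left (EReal.coe_ennreal_nonneg _))

theorem exists_isDualSolution (h0 : (0 : Fin d → ℤ) ∈ Λ) (hsymm : ∀ k ∈ Λ, -k ∈ Λ) (hν : 2 ≤ ν)
    (hl : 0 ≤ l) (hc : c ∈ covSet Λ) (m : symSeq (Λ.erase 0)) :
    ∃ x, IsDualSolution Λ ν l c m x := by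
  obtain ⟨x₀, hx₀⟩ := posPolyOne_prod_posPoly_nonempty h0
  obtain ⟨ε, hε, M, hlower⟩ := exists_le_regDual hsymm ν l hc m
  set r : ℝ := ∫ t, dualDensity ν l (polyP x₀.1 t) (trigPoly x₀.2 t) ∂torusMeasure d -
    pairing Λ x₀ (-c, m)
  refine exists_isMinOn_of_subset_isCompact (isClosed_closure.prod isClosed_closure)
    ((isCompact_closure_posPolyOne hsymm).prod (isCompact_closedBall 0 ((r + M) / ε)))
    (lowerSemicontinuous_regDual ν l c m) (prod_mono subset_closure subset_closure hx₀)
    fun x hx hle => ⟨hx.1, ?_⟩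
  rw [regDual_eq_coe hν hl hx₀] at hle
  have hbound : ε * ‖x.2‖ - M ≤ r := EReal.coe_le_coe_iff.1 ((hlower x hx).trans hle)
  rw [mem_closedBall_zero_iff, le_div_iff₀ hε]
  linarith

theorem momentMap_eq_of_isMinOn (hν : 2 ≤ ν) (hx : x ∈ posPolyOne Λ ×ˢ posPoly Λ)
    {w : symSeq Λ × symSeq (Λ.erase 0)}
    (hmin : IsMinOn (fun y => ∫ t, dualDensity ν l (polyP y.1 t) (trigPoly y.2 t) ∂torusMeasure d -
      pairing Λ y w) (posPolyOne Λ ×ˢ posPoly Λ) x) : momentMap Λ ν x l = w := by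
  refine sub_eq_zero.1 (eq_zero_of_forall_pairing_eq_zero fun v => ?_)
  have hpairing : HasLineDerivAt ℝ (fun y => pairing Λ y w) (pairing Λ v w) x v :=
    ((pairing Λ).flip w).hasFDerivAt.hasLineDerivAt v
  have hderiv := HasDerivAt.fun_sub ((uniformlySmoothAt_dualDensity hx).hasLineDerivAt_integral
    (μ := torusMeasure d) (hasLineDerivAt_dualDensity (l := l) hν hx v)) hpairing
  rw [map_sub, pairing_momentMap hx]
  exact (hmin.isLocalMin (isOpen_posPolyOne_prod_posPoly.mem_nhds hx)).hasLineDerivAt_eq_zero hderiv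

theorem IsDualSolution.mem_and_momentMap_eq (hx : IsDualSolution Λ ν l c m x) (hd : 0 < d)
    (h0 : (0 : Fin d → ℤ) ∈ Λ) (hν : 2 ≤ ν) (hνd : d ≤ 2 * (ν - 1)) (hl : 0 < l) :
    x ∈ posPolyOne Λ ×ˢ posPoly Λ ∧ momentMap Λ ν x l = (-c, m) := by
  have hle : ∀ y ∈ posPolyOne Λ ×ˢ posPoly Λ, regDual Λ ν l c m x ≤ regDual Λ ν l c m y :=
    fun y hy => hx.2 (prod_mono subset_closure subset_closure hy)
  have hxU : x ∈ posPolyOne Λ ×ˢ posPoly Λ := by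
    by_contra hxU
    obtain ⟨x₀, hx₀⟩ := posPolyOne_prod_posPoly_nonempty h0
    have htop := hle x₀ hx₀
    rw [regDual_eq_top hd hν hνd hl hx.1 hxU, regDual_eq_coe hν hl.le hx₀] at htop
    exact EReal.coe_ne_top _ (top_le_iff.1 htop)
  refine ⟨hxU, momentMap_eq_of_isMinOn hν hxU fun y hy => ?_⟩
  have hxy := hle y hy
  rwa [regDual_eq_coe hν hl.le hxU, regDual_eq_coe hν hl.le hy, EReal.coe_le_coe_iff] at hxy

end DualProblem

section WellPosedness

variable {Λ : Finset (Fin d → ℤ)} {ν : ℕ} {l : ℝ} {c : symSeq Λ} {m : symSeq (Λ.erase 0)}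
  {x : symSeq (Λ.erase 0) × symSeq Λ}

theorem neg_momentMap_fst_mem_covSet (ν : ℕ) (l : ℝ) (hx : x ∈ posPolyOne Λ ×ˢ posPoly Λ) :
    -(momentMap Λ ν x l).1 ∈ covSet Λ := by
  have hpos : ∀ t, 0 < (polyP x.1 t / trigPoly x.2 t) ^ ν := fun t =>
    pow_pos (div_pos (hx.1 t) (hx.2 t)) ν
  exact ⟨fun t => (polyP x.1 t / trigPoly x.2 t) ^ ν,
    integrable_of_continuous (uniformlySmoothAt_ratio_pow hx.2 ν).continuous,
    fun t => (hpos t).le, ⟨0, 1, one_pos, fun t _ => hpos t⟩,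
    fun t => by simp only [polyP, trigPoly_neg_apply], neg_neg _⟩

theorem image_momentMap (hd : 0 < d) (h0 : (0 : Fin d → ℤ) ∈ Λ) (hsymm : ∀ k ∈ Λ, -k ∈ Λ)
    (hν : 2 ≤ ν) (hνd : d ≤ 2 * (ν - 1)) :
    (fun z : (symSeq (Λ.erase 0) × symSeq Λ) × ℝ => (momentMap Λ ν z.1 z.2, z.2)) ''
        ((posPolyOne Λ ×ˢ posPoly Λ) ×ˢ Ioi 0) =
      (((fun c => -c) '' covSet Λ) ×ˢ (univ : Set (symSeq (Λ.erase 0)))) ×ˢ Ioi 0 := by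
  apply subset_antisymm
  · rintro _ ⟨⟨x, l⟩, ⟨hx, hl⟩, rfl⟩
    exact ⟨⟨⟨_, neg_momentMap_fst_mem_covSet ν l hx, neg_neg _⟩, mem_univ _⟩, hl⟩
  · rintro ⟨⟨_, m⟩, l⟩ ⟨⟨⟨c, hc, rfl⟩, -⟩, hl⟩
    obtain ⟨x, hx⟩ := exists_isDualSolution h0 hsymm hν (mem_Ioi.1 hl).le hc m
    obtain ⟨hxU, hxm⟩ := hx.mem_and_momentMap_eq hd h0 hν hνd hl
    exact ⟨(x, l), ⟨hxU, hl⟩, Prod.ext hxm rfl⟩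

theorem isSmoothDiffeoOn_momentMap_prodMk (hd : 0 < d) (h0 : (0 : Fin d → ℤ) ∈ Λ)
    (hsymm : ∀ k ∈ Λ, -k ∈ Λ) (hν : 2 ≤ ν) (hνd : d ≤ 2 * (ν - 1)) :
    IsSmoothDiffeoOn (fun z : (symSeq (Λ.erase 0) × symSeq Λ) × ℝ => (momentMap Λ ν z.1 z.2, z.2))
      ((posPolyOne Λ ×ˢ posPoly Λ) ×ˢ Ioi 0)
      ((((fun c => -c) '' covSet Λ) ×ˢ (univ : Set (symSeq (Λ.erase 0)))) ×ˢ Ioi 0) :=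
  image_momentMap hd h0 hsymm hν hνd ▸ isSmoothDiffeoOn_momentMap_image hsymm hν

theorem isSmoothDiffeoOn_momentMap (hd : 0 < d) (h0 : (0 : Fin d → ℤ) ∈ Λ)
    (hsymm : ∀ k ∈ Λ, -k ∈ Λ) (hν : 2 ≤ ν) (hνd : d ≤ 2 * (ν - 1)) (hl : 0 < l) :
    IsSmoothDiffeoOn (fun x => momentMap Λ ν x l) (posPolyOne Λ ×ˢ posPoly Λ)
      (((fun c => -c) '' covSet Λ) ×ˢ (univ : Set (symSeq (Λ.erase 0)))) :=
  (isSmoothDiffeoOn_momentMap_prodMk hd h0 hsymm hν hνd).slice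
    (f := fun z => momentMap Λ ν z.1 z.2) hl

theorem existsUnique_momentMap_eq (hd : 0 < d) (h0 : (0 : Fin d → ℤ) ∈ Λ)
    (hsymm : ∀ k ∈ Λ, -k ∈ Λ) (hν : 2 ≤ ν) (hνd : d ≤ 2 * (ν - 1)) (hl : 0 < l)
    (hc : c ∈ covSet Λ) (m : symSeq (Λ.erase 0)) :
    ∃! x, x ∈ posPolyOne Λ ×ˢ posPoly Λ ∧ momentMap Λ ν x l = (-c, m) := by
  have hbij := (isSmoothDiffeoOn_momentMap hd h0 hsymm hν hνd hl).2.2.1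
  obtain ⟨x, hx, hxm⟩ := hbij.surjOn (show (-c, m) ∈ _ from ⟨⟨c, hc, rfl⟩, mem_univ m⟩)
  exact ⟨x, ⟨hx, hxm⟩, fun y hy => hbij.injOn hy.1 hx (hy.2.trans hxm.symm)⟩

theorem isDualSolution_iff (hd : 0 < d) (h0 : (0 : Fin d → ℤ) ∈ Λ) (hsymm : ∀ k ∈ Λ, -k ∈ Λ)
    (hν : 2 ≤ ν) (hνd : d ≤ 2 * (ν - 1)) (hl : 0 < l) (hc : c ∈ covSet Λ) :
    IsDualSolution Λ ν l c m x ↔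
      x ∈ posPolyOne Λ ×ˢ posPoly Λ ∧ momentMap Λ ν x l = (-c, m) := by
  refine ⟨fun hx => hx.mem_and_momentMap_eq hd h0 hν hνd hl, fun hx => ?_⟩
  obtain ⟨y, hy⟩ := exists_isDualSolution h0 hsymm hν hl.le hc m
  rwa [(existsUnique_momentMap_eq hd h0 hsymm hν hνd hl hc m).unique hx
    (hy.mem_and_momentMap_eq hd h0 hν hνd hl)]

theorem contDiffOn_of_momentMap_eq {E : Type*} [NormedAddCommGroup E] [NormedSpace ℝ E]
    (hd : 0 < d) (h0 : (0 : Fin d → ℤ) ∈ Λ) (hsymm : ∀ k ∈ Λ, -k ∈ Λ) (hν : 2 ≤ ν)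
    (hνd : d ≤ 2 * (ν - 1)) {s : E → symSeq (Λ.erase 0) × symSeq Λ}
    {w : E → symSeq Λ × symSeq (Λ.erase 0)} {r : E → ℝ} {A : Set E} (hw : ContDiffOn ℝ ∞ w A)
    (hr : ContDiffOn ℝ ∞ r A) (hr_pos : ∀ y ∈ A, 0 < r y)
    (hs : ∀ y ∈ A, s y ∈ posPolyOne Λ ×ˢ posPoly Λ ∧ momentMap Λ ν (s y) (r y) = w y) :
    ContDiffOn ℝ ∞ s A := by
  have hsr : ContDiffOn ℝ ∞ (fun y => (s y, r y)) A :=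
    (isSmoothDiffeoOn_momentMap_prodMk hd h0 hsymm hν hνd).contDiffOn_of_comp
      (fun y hy => ⟨(hs y hy).1, hr_pos y hy⟩)
      ((hw.prodMk hr).congr fun y hy => Prod.ext (hs y hy).2 rfl)
  exact hsr.fst

end WellPosedness

end

end CepstralMoment

open CepstralMoment in
theorem mainTheorem2 (d : ℕ) (hd : 0 < d) (Λ : Finset (Fin d → ℤ)) (h0 : (0 : Fin d → ℤ) ∈ Λ)
    (hsymm : ∀ k ∈ Λ, -k ∈ Λ) (ν : ℕ) (hν : (d : ℝ) / 2 + 1 ≤ (ν : ℝ)) :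
    -- for fixed `l`, the moment map is a smooth diffeomorphism
    (∀ l : ℝ, 0 < l →
      IsSmoothDiffeoOn (fun x => momentMap Λ ν x l) (posPolyOne Λ ×ˢ posPoly Λ)
        (((fun c => -c) '' covSet Λ) ×ˢ (Set.univ : Set (symSeq (Λ.erase 0))))) ∧
    -- for fixed data, the moment equations have a unique solution, which is smooth in `l`
    (∀ c ∈ covSet Λ, ∀ m : symSeq (Λ.erase 0),
      (∀ l : ℝ, 0 < l → ∃! x, x ∈ posPolyOne Λ ×ˢ posPoly Λ ∧ momentMap Λ ν x l = (-c, m)) ∧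
      ∀ sol : ℝ → symSeq (Λ.erase 0) × symSeq Λ,
        (∀ l : ℝ, 0 < l →
          sol l ∈ posPolyOne Λ ×ˢ posPoly Λ ∧ momentMap Λ ν (sol l) l = (-c, m)) →
        ContDiffOn ℝ ∞ sol (Set.Ioi 0)) ∧
    -- well-posedness of the regularized dual problem: the solution exists, is unique, solves the
    -- moment equations, and depends continuously on the data `(c, m)` and on `l`
    (∀ c ∈ covSet Λ, ∀ m : symSeq (Λ.erase 0), ∀ l : ℝ, 0 < l →
      (∃! x, IsDualSolution Λ ν l c m x) ∧
      ∀ x, IsDualSolution Λ ν l c m x ↔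
        x ∈ posPolyOne Λ ×ˢ posPoly Λ ∧ momentMap Λ ν x l = (-c, m)) ∧
    ∀ S : (symSeq Λ × symSeq (Λ.erase 0)) × ℝ → symSeq (Λ.erase 0) × symSeq Λ,
      (∀ c ∈ covSet Λ, ∀ m : symSeq (Λ.erase 0), ∀ l : ℝ, 0 < l →
        IsDualSolution Λ ν l c m (S ((c, m), l))) →
      ContinuousOn S
        ((covSet Λ ×ˢ (Set.univ : Set (symSeq (Λ.erase 0)))) ×ˢ Set.Ioi (0 : ℝ)) := by
  have hd1 : (1 : ℝ) ≤ d := Nat.one_le_cast.2 hd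
  have hν2 : 2 ≤ ν := Nat.one_lt_cast.1 (show (1 : ℝ) < ν by linarith)
  have hνd : d ≤ 2 * (ν - 1) := by
    have h : (d : ℝ) + 2 ≤ 2 * ν := by linarith
    norm_cast at h
    lia
  refine ⟨fun l hl => isSmoothDiffeoOn_momentMap hd h0 hsymm hν2 hνd hl, fun c hc m =>
      ⟨fun l hl => existsUnique_momentMap_eq hd h0 hsymm hν2 hνd hl hc m, fun sol hsol => ?_⟩,
    fun c hc m l hl => ?_, fun S hS => ?_⟩
  · exact contDiffOn_of_momentMap_eq (r := id) hd h0 hsymm hν2 hνd contDiffOn_const contDiffOn_id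
      (fun l hl => hl) hsol
  · have hiff := fun x => isDualSolution_iff (x := x) (m := m) hd h0 hsymm hν2 hνd hl hc
    exact ⟨by simpa only [hiff] using existsUnique_momentMap_eq hd h0 hsymm hν2 hνd hl hc m, hiff⟩
  · have hmoment : ∀ z ∈ (covSet Λ ×ˢ (univ : Set (symSeq (Λ.erase 0)))) ×ˢ Ioi (0 : ℝ),
        S z ∈ posPolyOne Λ ×ˢ posPoly Λ ∧ momentMap Λ ν (S z) z.2 = (-z.1.1, z.1.2) := fun z hz =>
      (hS z.1.1 hz.1.1 z.1.2 z.2 hz.2).mem_and_momentMap_eq hd h0 hν2 hνd hz.2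
    exact (contDiffOn_of_momentMap_eq hd h0 hsymm hν2 hνd (by fun_prop) contDiffOn_snd
      (fun z hz => hz.2) hmoment).continuousOn
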